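/- Let $A$ be a finite alphabet with $|A|\ge 2$ and let $\log$ be the logarithm to base $2$. For every $n$ let $d$ be a real-valued distortion measure between vectors of $A^n$ that is subadditive: $d(u u';v v')\le d(u;v)+d(u';v')$ for all $u,v\in A^i$, $u',v'\in A^j$, $i,j\ge 1$. Let $d_{\max}\in\mathbb R$ be such that every vector $u\in A^n$, $n\ge1$, has some $v\in A^n$ with $d(u;v)\le n\,d_{\max}$ (which is automatic if $d(u;u)=0$ and $d_{\max}\ge 0$). Let $\mathbf x=x_1x_2\cdots$ be an arbitrary infinite sequence over $A$, and for each $L$ let $X_L(1),X_L(2),\dots$ be its consecutive non-overlapping $L$-vectors. Finite-state distortion-limited (FSDL) compressibility. An $s$-state FSDL encoder for $L$-vectors consists of a state set $S$ with $s$ elements, a next-state map $g:S\times A^L\to S$ and an output map $f:S\times A^L\to\{0,1\}^*$ such that, for every state $\sigma$ and every $u\in A^L$, the start state $\sigma$, the end state $g(\sigma,u)$ and the (possibly empty) word $f(\sigma,u)$ together determine a vector $v\in A^L$ with $d(u;v)\le L\,d_{\max}$. Let $\mathrm{FSLD}_s(x_1^{cL};d_{\max}|L)$ be the minimum, over all such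 encoders and start states, of $\frac{1}{cL\log|A|}$ times the total number of bits produced when the encoder reads $X_L(1),\dots,X_L(c)$ in succession, and let $$\mathrm{FSLD}(\mathbf x;d_{\max})=\limsup_{s\to\infty}\ \limsup_{L\to\infty}\ \limsup_{c\to\infty}\ \mathrm{FSLD}_s(x_1^{cL};d_{\max}|L).$$ The scheme. For each $L\ge1$ let $D=D_L=2^{L^3}$, so that $\log D=L^3$, and let $N=N_L$ be any multiple of $L$ with $N\ge D\log D$. Cut $\mathbf x$ into consecutive strings of $N$ letters, that is, of $N/L$ $L$-vectors. Quantize each string greedily: choose $z(1)\in A^L$ that covers (is within distortion at most $L\,d_{\max}$ of) the largest number of the $L$-vectors in the string, and replace these by $z(1)$; choose $z(2)\in A^L$ that covers the largest number of the remaining $L$-vectors, and replace these by $z(2)$; and so on until all are replaced (ties are broken arbitrarily). Feed the quantized strings one after the other into LZ78(LRU) over the alphabet $A^L$: each new phrase is the longest phrase in the dictionary that matches the incoming input (if there is one), extended by the next letter of $A^L$; a phrase of at most $L_{\max}=(\log D)^2$ letters of $A^L$ is then put into the dictionary, which keeps $D$ phrases by removal of the least recently used one, whereas a phrase of $L_{\max}+1$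 letters leaves the dictionary unchanged. Here a phrase counts as used either only when it is generated, or when it is generated or copied; the result holds under both conventions. The code length of each phrase is $\log D+1+\log|A^L|$ bits. Let $\rho_L(\mathbf x)$ be the limit superior, as $K\to\infty$, of the code length for the first $K$ strings divided by $KN\log|A|$. Theorem. For every $L\ge1$ the greedy quantization can be carried out, and it replaces every $L$-vector by one within distortion $L\,d_{\max}$ of it. However $N_L$ is chosen and ties are broken, the compression ratio of the combined scheme converges to the compressibility: $$\lim_{L\to\infty}\rho_L(\mathbf x)=\mathrm{FSLD}(\mathbf x;d_{\max}),$$ that is, the scheme asymptotically achieves $\mathrm{FSLD}(\mathbf x;d_{\max})$ as the dictionary size $D=2^{L^3}$ tends to infinity. -/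

import Mathlib

open Filter Topology

noncomputable section

/-! ### Blocks and the distortion measure -/

/-- The `m`-th (from `0`) of the consecutive non-overlapping `L`-vectors of the sequence `x`. -/
def block {A : Type*} (x : ℕ → A) (L m : ℕ) : Fin L → A :=
  fun i => x (m * L + i)

/-- Subadditivity of a family of distortion measures, one for each vector length. -/
def SubadditiveDistortion {A : Type*} (d : (n : ℕ) → (Fin n → A) → (Fin n → A) → ℝ) : Prop :=
  ∀ i j : ℕ, 1 ≤ i → 1 ≤ j → ∀ (u v : Fin i → A) (u' v' : Fin j → A),
    d (i + j) (Fin.append u u') (Fin.append v v') ≤ d i u v + d j u' v'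

/-- Every vector can be reproduced within the allowed distortion. This holds in particular if
`0 ≤ dmax` and every vector is at distance `0` from itself. -/
def AdmitsReproduction {A : Type*} (d : (n : ℕ) → (Fin n → A) → (Fin n → A) → ℝ)
    (dmax : ℝ) : Prop :=
  ∀ n : ℕ, 1 ≤ n → ∀ u : Fin n → A, ∃ v : Fin n → A, d n u v ≤ n * dmax

/-! ### Finite-state distortion-limited compressibility -/

/-- A finite-state distortion-limited encoder with `s` states for `L`-vectors: next-state function,
binary output words, and a decoder that turns start state, end state and output word into a
reproduction vector within the allowed distortion. -/
structure FSDLEncoder {A : Type*} (d : (n : ℕ) → (Fin n → A) → (Fin n → A) → ℝ) (dmax : ℝ)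
    (L s : ℕ) where
  next : Fin s → (Fin L → A) → Fin s
  out : Fin s → (Fin L → A) → List Bool
  decode : Fin s → Fin s → List Bool → (Fin L → A)
  distortion_le : ∀ (q : Fin s) (u : Fin L → A),
    d L u (decode q (next q u) (out q u)) ≤ L * dmax

namespace FSDLEncoder

variable {A : Type*} {d : (n : ℕ) → (Fin n → A) → (Fin n → A) → ℝ} {dmax : ℝ} {L s : ℕ}

/-- The state in which the encoder, started in `q`, reads the `m`-th `L`-vector of `x`. -/
def stateAt (E : FSDLEncoder d dmax L s) (q : Fin s) (x : ℕ → A) : ℕ → Fin s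
  | 0 => q
  | m + 1 => E.next (E.stateAt q x m) (block x L m)

/-- The number of bits produced for the first `c` of the `L`-vectors of `x`. -/
def bits (E : FSDLEncoder d dmax L s) (q : Fin s) (x : ℕ → A) (c : ℕ) : ℕ :=
  ∑ m ∈ Finset.range c, (E.out (E.stateAt q x m) (block x L m)).length

end FSDLEncoder

/-- The least compression ratio for the first `c` of the `L`-vectors of `x` (that is, for its first
`N = c * L` letters) among the `s`-state encoders and their start states. -/
def FSLDFinite {A : Type*} [Fintype A] (d : (n : ℕ) → (Fin n → A) → (Fin n → A) → ℝ) (dmax : ℝ)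
    (s L c : ℕ) (x : ℕ → A) : EReal :=
  ⨅ (E : FSDLEncoder d dmax L s) (q : Fin s),
    (((E.bits q x c : ℝ) / (((c * L : ℕ) : ℝ) * Real.logb 2 (Fintype.card A)) : ℝ) : EReal)

/-- The finite-state distortion-limited compressibility of `x`. -/
def FSLD {A : Type*} [Fintype A] (d : (n : ℕ) → (Fin n → A) → (Fin n → A) → ℝ) (dmax : ℝ)
    (x : ℕ → A) : EReal :=
  limsup (fun s : ℕ => limsup (fun L : ℕ => limsup (fun c : ℕ =>
    FSLDFinite d dmax s L c x) atTop) atTop) atTop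

/-! ### The greedy adaptive vector quantizer -/

open Classical in
/-- The indices of the `L`-vectors among `B` that are still unreplaced after the representatives
`z 0, …, z (i - 1)` have been used. -/
def unreplaced {A : Type*} (d : (n : ℕ) → (Fin n → A) → (Fin n → A) → ℝ) (dmax : ℝ) {L M : ℕ}
    (B : Fin M → Fin L → A) (z : ℕ → Fin L → A) (i : ℕ) : Finset (Fin M) :=
  {m | ∀ j < i, ¬ d L (B m) (z j) ≤ L * dmax}

open Classical in
/-- The number of indices in `R` whose `L`-vector is covered by `w`. -/
def coverCount {A : Type*} (d : (n : ℕ) → (Fin n → A) → (Fin n → A) → ℝ) (dmax : ℝ) {L M : ℕ}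
    (B : Fin M → Fin L → A) (R : Finset (Fin M)) (w : Fin L → A) : ℕ :=
  (R.filter fun m => d L (B m) w ≤ L * dmax).card

/-- `Q` is obtained from the string of `L`-vectors `B` by the greedy quantizer (with some way of
breaking ties): `z i` covers the largest number of the vectors that are unreplaced at step `i`, the
vectors that it covers are replaced by it, and in the end every vector is replaced. (When nothing is
left the choice of `z i` is immaterial.) -/
def IsGreedyQuantization {A : Type*} (d : (n : ℕ) → (Fin n → A) → (Fin n → A) → ℝ) (dmax : ℝ)
    {L M : ℕ} (B Q : Fin M → Fin L → A) : Prop :=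
  ∃ z : ℕ → Fin L → A,
    (∀ (i : ℕ) (w : Fin L → A),
      coverCount d dmax B (unreplaced d dmax B z i) w ≤
        coverCount d dmax B (unreplaced d dmax B z i) (z i)) ∧
    ∀ m : Fin M, ∃ i : ℕ,
      m ∈ unreplaced d dmax B z i ∧ d L (B m) (z i) ≤ L * dmax ∧ Q m = z i

/-- `z` is the sequence of quantized `L`-vectors of `x`, where `x` is cut into consecutive strings
of `N` letters (`N / L` vectors each) and each string is quantized greedily on its own. -/
def IsGreedyOutput {A : Type*} (d : (n : ℕ) → (Fin n → A) → (Fin n → A) → ℝ) (dmax : ℝ)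
    (x : ℕ → A) (L N : ℕ) (z : ℕ → Fin L → A) : Prop :=
  ∀ k : ℕ, IsGreedyQuantization d dmax
    (fun m : Fin (N / L) => block x L (k * (N / L) + m))
    (fun m : Fin (N / L) => z (k * (N / L) + m))

/-! ### LZ78 with a dictionary of bounded size and LRU deletion -/

/-- What counts as a use of a dictionary phrase for LRU deletion: only its generation (so that the
dictionary holds the most recently generated phrases), or also its being copied as the matched part
of a new phrase. -/
inductive UseRule
  | generated
  | generatedOrCopied

/-- The word of length `l` that starts at position `p` of `z`. -/
def word {B : Type*} (z : ℕ → B) (p l : ℕ) : List B :=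
  (List.range l).map fun i => z (p + i)

open Classical in
/-- The length of the longest dictionary phrase that matches `z` at position `p` (`0` if none). -/
def matchLength {B : Type*} (z : ℕ → B) (dict : List (List B)) (p : ℕ) : ℕ :=
  ((dict.filter fun u => u = word z p u.length).map List.length).foldr max 0

/-- State of the parsing: the dictionary, most recently used phrase first, and the position in the
input at which the next phrase starts. -/
structure LZState (B : Type*) where
  dict : List (List B)
  pos : ℕ

open Classical in
/-- Generate one phrase: the longest match, extended by the next letter. A phrase of at most `Lmax`
letters enters the dictionary and, if there are then more than `D` phrases, the least recently used
one is removed; a phrase of `Lmax + 1` letters leaves the dictionary as it is. -/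
def lzStep {B : Type*} (rule : UseRule) (D Lmax : ℕ) (z : ℕ → B) (S : LZState B) : LZState B :=
  let l := matchLength z S.dict S.pos
  let new := word z S.pos (l + 1)
  { dict :=
      if l + 1 ≤ Lmax then
        match rule with
        | .generated => (new :: S.dict).take D
        | .generatedOrCopied =>
          if l = 0 then (new :: S.dict).take D
          else (new :: word z S.pos l :: S.dict.erase (word z S.pos l)).take D
      else S.dict
    pos := S.pos + (l + 1) }

/-- The state of LZ78(LRU) with a `D`-entry dictionary after `j` phrases of `z`; dictionary phrases
have at most `(log D)^2` letters, and the dictionary is empty at the start. -/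
def lzRun {B : Type*} (rule : UseRule) (D : ℕ) (z : ℕ → B) : ℕ → LZState B
  | 0 => { dict := [], pos := 0 }
  | j + 1 => lzStep rule D (Nat.log 2 D ^ 2) z (lzRun rule D z j)

/-- The number of phrases (the last one possibly incomplete) into which LZ78(LRU) parses the first
`n` letters of `z`. Phrases are non-empty, so phrase number `j` starts at or after `j`. -/
def lzPhrases {B : Type*} (rule : UseRule) (D : ℕ) (z : ℕ → B) (n : ℕ) : ℕ :=
  ((Finset.range n).filter fun j => (lzRun rule D z j).pos < n).card

/-- The code length, in bits, of LZ78(LRU) for the first `n` letters of `z`. -/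
def lzBits {B : Type*} [Fintype B] (rule : UseRule) (D : ℕ) (z : ℕ → B) (n : ℕ) : ℝ :=
  lzPhrases rule D z n * (Real.logb 2 D + 1 + Real.logb 2 (Fintype.card B))

/-! ### The combined scheme -/

/-- The dictionary size `D` with `log D = L ^ 3`. -/
def dictSize (L : ℕ) : ℕ := 2 ^ (L ^ 3)

/-- The compression ratio, relative to the source letters, of LZ78(LRU) over the alphabet of
`L`-vectors fed with the quantized sequence `z`: the limit superior over the number `K` of
consecutive `N`-letter strings that have been encoded. -/
def schemeRatio {A : Type*} [Fintype A] (rule : UseRule) (L N : ℕ) (z : ℕ → Fin L → A) : EReal :=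
  limsup (fun K : ℕ =>
    ((lzBits rule (dictSize L) z (K * (N / L)) /
      (((K * N : ℕ) : ℝ) * Real.logb 2 (Fintype.card A)) : ℝ) : EReal)) atTop

end

/-!
Both the scheme and the best finite-state encoders are compared through the same quantity: the
number of bits needed to name, with a one-to-one code, a reproduction of each `L`-vector. Finitely
many states change this number by `2 * log s` per vector only, which vanishes relative to `L`.

*Finite-state encoders are no worse than the scheme* (`FSLD_le_schemeRatio`), and this holds for
each fixed `L`, not only in the limit. A long vector of length `L'` contains a stretch of the
quantized sequence, which is determined by the dictionary at its start and by the tokens of the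
phrases that start in it; its incomplete `L`-vectors at both ends are reproduced separately, by
subadditivity. Apart from the tokens there are only finitely many possibilities, independently of
`L'`. So few vectors have short descriptions, and a memoryless encoder can number the vectors of
`A ^ L'` in the order of their description lengths (`FSLDFinite_le_of_codebooks`). The additional
cost per vector is bounded as `L'` grows.

*The scheme is no worse than finite-state encoders for the same `L`, up to a vanishing term*
(`limsup_schemeRatio_le`). Two facts carry this.

* The greedy quantizer is the greedy algorithm for minimum entropy set cover, and its empirical
  entropy exceeds that of any other covering by at most one nat per vector
  (`IsGreedyQuantization.sum_log_card_ge`). A finite-state encoder covers the string by the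
  classes of equal start state, end state and output word, and its bits bound the entropy of that
  covering by a damped Kraft inequality (`IsGreedyQuantization.entropy_le`).
* Under both use rules a phrase that enters the dictionary moves back by at most two places with
  each new phrase, so it is not generated again within `D / 2` phrases (`half_le_of_lzPhrase_eq`).
  Hence a word occurs among `n` consecutive phrases at most `n / (D / 2) + 1` times. Since the
  probabilities of the words of one length add up to at most `1`, all but few phrases have
  probability at most about `1 / D` under the empirical distribution of the letters of a string,
  that is, each phrase pays for about `log D` bits of entropy (`lzPhrases_sub_mul_le`).

Each string has at least `D` vectors, and with `log D = L ^ 3` the remaining overheads are all of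
smaller order than the source length.
-/

/-! ### Parsing: phrases, positions and the dictionary -/

section Parsing

variable {B : Type*}

@[simp] lemma length_word (z : ℕ → B) (p l : ℕ) : (word z p l).length = l := by simp [word]

lemma word_succ (z : ℕ → B) (p l : ℕ) : word z p (l + 1) = word z p l ++ [z (p + l)] := by
  simp [word, List.range_succ]

lemma word_append (z : ℕ → B) (p l k : ℕ) : word z p l ++ word z (p + l) k = word z p (l + k) := by
  induction k with
  | zero => simp [word]
  | succ k ih => rw [word_succ, ← List.append_assoc, ih, ← add_assoc l, word_succ, add_assoc]

lemma le_foldr_max {l : List ℕ} {a : ℕ} (h : a ∈ l) : a ≤ l.foldr max 0 := by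
  induction l with
  | nil => simp at h
  | cons b l ih =>
    rcases List.mem_cons.1 h with rfl | h
    · exact le_max_left _ _
    · exact (ih h).trans (le_max_right _ _)

lemma foldr_max_mem {l : List ℕ} (h : l.foldr max 0 ≠ 0) : l.foldr max 0 ∈ l := by
  induction l with
  | nil => simp at h
  | cons b l ih =>
    rw [List.foldr_cons] at h ⊢
    rcases le_total (l.foldr max 0) b with hb | hb
    · rw [max_eq_left hb]; exact List.mem_cons_self
    · rw [max_eq_right hb] at h ⊢
      exact List.mem_cons_of_mem _ (ih h)

lemma le_matchLength (z : ℕ → B) {dict : List (List B)} {p l : ℕ} (h : word z p l ∈ dict) :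
    l ≤ matchLength z dict p := by
  classical
  refine le_foldr_max (List.mem_map.2 ⟨word z p l, List.mem_filter.2 ⟨h, ?_⟩, by simp⟩)
  simp

lemma word_matchLength_mem (z : ℕ → B) {dict : List (List B)} {p : ℕ}
    (h : matchLength z dict p ≠ 0) : word z p (matchLength z dict p) ∈ dict := by
  classical
  obtain ⟨u, hu, hul⟩ := List.mem_map.1 (foldr_max_mem h)
  have h2 := List.mem_filter.1 hu
  have h3 : u = word z p u.length := by simpa using h2.2
  have h4 : u.length = matchLength z dict p := hul
  rw [← h4, ← h3]
  exact h2.1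

open Classical in
/-- The dictionary after a phrase has been formed by extending the match `m` by the letter `b`.
It depends on the input only through `m` and `b`, so that a decoder can compute it. -/
noncomputable def lzUpdate (rule : UseRule) (D Lmax : ℕ) (dict : List (List B)) (m : List B)
    (b : B) : List (List B) :=
  if m.length + 1 ≤ Lmax then
    match rule with
    | .generated => ((m ++ [b]) :: dict).take D
    | .generatedOrCopied =>
      if m.length = 0 then ((m ++ [b]) :: dict).take D
      else ((m ++ [b]) :: m :: dict.erase m).take D
  else dict

variable (rule : UseRule) (D : ℕ) (z : ℕ → B)

/-- The length of the match on which phrase number `j` is built; the phrase is one letter longer. -/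
noncomputable def lzMatch (j : ℕ) : ℕ :=
  matchLength z (lzRun rule D z j).dict (lzRun rule D z j).pos

lemma lzRun_succ_pos (j : ℕ) :
    (lzRun rule D z (j + 1)).pos = (lzRun rule D z j).pos + (lzMatch rule D z j + 1) := rfl

lemma lzRun_succ_dict (j : ℕ) :
    (lzRun rule D z (j + 1)).dict = lzUpdate rule D (Nat.log 2 D ^ 2) (lzRun rule D z j).dict
      (word z (lzRun rule D z j).pos (lzMatch rule D z j))
      (z ((lzRun rule D z j).pos + lzMatch rule D z j)) := by
  unfold lzUpdate
  rw [← word_succ, length_word]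
  rfl

/-- Phrase number `j` of the parsing. -/
noncomputable def lzPhrase (j : ℕ) : List B :=
  word z (lzRun rule D z j).pos (lzMatch rule D z j + 1)

lemma length_lzPhrase (j : ℕ) : (lzPhrase rule D z j).length = lzMatch rule D z j + 1 := by
  simp [lzPhrase]

lemma lzPhrase_not_mem (j : ℕ) : lzPhrase rule D z j ∉ (lzRun rule D z j).dict := fun h =>
  absurd (le_matchLength z h) (Nat.not_succ_le_self _)

open Classical in
lemma lzUpdate_of_le {Lmax : ℕ} (dict : List (List B)) {m : List B} (b : B)
    (h : m.length + 1 ≤ Lmax) :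
    lzUpdate rule D Lmax dict m b = ((m ++ [b]) :: dict).take D ∨
      lzUpdate rule D Lmax dict m b = ((m ++ [b]) :: m :: dict.erase m).take D := by
  unfold lzUpdate
  rw [if_pos h]
  cases rule
  · exact Or.inl rfl
  · by_cases h0 : m.length = 0
    · exact Or.inl (if_pos h0)
    · exact Or.inr (if_neg h0)

lemma lzUpdate_of_not_le {Lmax : ℕ} (dict : List (List B)) {m : List B} (b : B)
    (h : ¬ m.length + 1 ≤ Lmax) : lzUpdate rule D Lmax dict m b = dict := if_neg h

lemma mem_lzUpdate {Lmax : ℕ} {dict : List (List B)} {m : List B} {b : B} {u : List B}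
    (h : u ∈ lzUpdate rule D Lmax dict m b) :
    u ∈ dict ∨ (u = m ++ [b] ∧ m.length + 1 ≤ Lmax) ∨ (u = m ∧ m.length + 1 ≤ Lmax) := by
  classical
  by_cases hc : m.length + 1 ≤ Lmax
  · rcases lzUpdate_of_le rule D dict b hc with he | he
    · have := List.mem_of_mem_take (he ▸ h)
      simp only [List.mem_cons] at this
      tauto
    · have := List.mem_of_mem_take (he ▸ h)
      simp only [List.mem_cons] at this
      rcases this with h | h | h
      · tauto
      · tauto
      · exact Or.inl (List.mem_of_mem_erase h)
  · rw [lzUpdate_of_not_le rule D dict b hc] at h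
    exact Or.inl h

lemma length_lzUpdate_le {Lmax : ℕ} {dict : List (List B)} {m : List B} {b : B}
    (h : dict.length ≤ D) : (lzUpdate rule D Lmax dict m b).length ≤ D := by
  by_cases hc : m.length + 1 ≤ Lmax
  · rcases lzUpdate_of_le rule D dict b hc with he | he <;> rw [he] <;>
      exact List.length_take_le _ _
  · rwa [lzUpdate_of_not_le rule D dict b hc]

lemma length_lzRun_dict_le (j : ℕ) : (lzRun rule D z j).dict.length ≤ D := by
  induction j with
  | zero => simp [lzRun]
  | succ j ih => rw [lzRun_succ_dict]; exact length_lzUpdate_le rule D ih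

lemma length_le_of_mem_lzRun_dict (j : ℕ) :
    ∀ u ∈ (lzRun rule D z j).dict, u.length ≤ Nat.log 2 D ^ 2 := by
  induction j with
  | zero => simp [lzRun]
  | succ j ih =>
    intro u hu
    rw [lzRun_succ_dict] at hu
    rcases mem_lzUpdate rule D hu with h | ⟨rfl, h⟩ | ⟨rfl, h⟩
    · exact ih u h
    · simpa using h
    · omega

lemma lzMatch_le (j : ℕ) : lzMatch rule D z j ≤ Nat.log 2 D ^ 2 := by
  by_cases h : lzMatch rule D z j = 0
  · omega
  · have := length_le_of_mem_lzRun_dict rule D z j _ (word_matchLength_mem z h)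
    rwa [length_word] at this

lemma lzRun_pos_strictMono : StrictMono fun j => (lzRun rule D z j).pos :=
  strictMono_nat_of_lt_succ fun j => by simp only [lzRun_succ_pos]; omega

lemma lt_lzPhrases_iff {n j : ℕ} : j < lzPhrases rule D z n ↔ (lzRun rule D z j).pos < n := by
  have hm := lzRun_pos_strictMono rule D z
  have hex : ∃ j, n ≤ (lzRun rule D z j).pos := ⟨n, hm.id_le n⟩
  have key : ∀ i, (lzRun rule D z i).pos < n ↔ i < Nat.find hex := fun i => by
    rw [Nat.lt_find_iff]
    exact ⟨fun h k hk => not_le.2 ((hm.monotone hk).trans_lt h), fun h => not_le.1 (h i le_rfl)⟩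
  have : ((Finset.range n).filter fun j => (lzRun rule D z j).pos < n)
      = Finset.range (Nat.find hex) := by
    ext i
    simp only [Finset.mem_filter, Finset.mem_range]
    rw [key]
    exact ⟨fun h => h.2, fun h => ⟨(hm.id_le i).trans_lt ((key i).2 h), h⟩⟩
  rw [lzPhrases, this, Finset.card_range, key]

lemma lzPhrases_mono : Monotone (lzPhrases rule D z) := fun a b hab => by
  by_contra! h
  have := (lt_lzPhrases_iff rule D z).1 h
  exact lt_irrefl _ ((lt_lzPhrases_iff rule D z).2 (this.trans_le hab))

lemma le_lzRun_pos_lzPhrases (n : ℕ) : n ≤ (lzRun rule D z (lzPhrases rule D z n)).pos := by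
  by_contra! h
  exact lt_irrefl _ ((lt_lzPhrases_iff rule D z).2 h)

/-- The first phrase that starts at or after `n` starts at most one phrase length after `n`. -/
lemma lzRun_pos_lzPhrases_le (n : ℕ) :
    (lzRun rule D z (lzPhrases rule D z n)).pos ≤ n + Nat.log 2 D ^ 2 := by
  rcases hJ : lzPhrases rule D z n with _ | j
  · simp [lzRun]
  · have h1 : (lzRun rule D z j).pos < n := (lt_lzPhrases_iff rule D z).1 (by omega)
    have h2 := lzMatch_le rule D z j
    rw [lzRun_succ_pos]
    omega

lemma lzPhrases_add_le (n k : ℕ) : lzPhrases rule D z (n + k) ≤ lzPhrases rule D z n + k := by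
  by_contra! h
  have h1 := (lt_lzPhrases_iff rule D z).1 h
  have h2 := le_lzRun_pos_lzPhrases rule D z n
  have h3 := (lzRun_pos_strictMono rule D z).add_le_nat k (lzPhrases rule D z n)
  rw [add_comm k (lzPhrases rule D z n)] at h3
  omega

end Parsing

/-! ### Recency: a phrase is not generated twice within half a dictionary -/

section Recency

variable {B : Type*}

lemma mem_take_erase [BEq B] [LawfulBEq B] {l : List B} {a c : B} {k : ℕ} (h : a ∈ l.take k)
    (hac : a ≠ c) : a ∈ (l.erase c).take k := by
  induction l generalizing k with
  | nil => simp at h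
  | cons b l ih =>
    rcases k with _ | k
    · simp at h
    · rw [List.take_succ_cons, List.mem_cons] at h
      rw [List.erase_cons]
      split_ifs with hb
      · have hbc : b = c := by simpa using hb
        rcases h with h | h
        · exact absurd (h.trans hbc) hac
        · exact List.take_subset_take_left l (Nat.le_succ k) h
      · rw [List.take_succ_cons, List.mem_cons]
        exact h.imp id ih

/-- Forming one phrase moves the other phrases back by at most two places: behind the new phrase
and behind the one that it was copied from. -/
lemma mem_take_lzUpdate (rule : UseRule) {D Lmax k : ℕ} {dict : List (List B)} {m u : List B}
    {b : B} (h : u ∈ dict.take k) (hk : k + 2 ≤ D) :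
    u ∈ (lzUpdate rule D Lmax dict m b).take (k + 2) := by
  classical
  by_cases hc : m.length + 1 ≤ Lmax
  · rcases lzUpdate_of_le rule D dict b hc with he | he <;>
      rw [he, List.take_take, min_eq_left hk, List.take_succ_cons]
    · exact List.mem_cons_of_mem _ (List.take_subset_take_left dict (Nat.le_succ k) h)
    · rw [List.take_succ_cons]
      by_cases hu : u = m
      · simp [hu]
      · exact List.mem_cons_of_mem _ (List.mem_cons_of_mem _ (mem_take_erase h hu))
  · rw [lzUpdate_of_not_le rule D dict b hc]
    exact List.take_subset_take_left dict (Nat.le_add_right k 2) h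

variable (rule : UseRule) (D : ℕ) (z : ℕ → B)

lemma lzPhrase_mem_take_succ {j : ℕ} (hD : 1 ≤ D) (h : lzMatch rule D z j + 1 ≤ Nat.log 2 D ^ 2) :
    lzPhrase rule D z j ∈ (lzRun rule D z (j + 1)).dict.take 1 := by
  rw [lzRun_succ_dict, lzPhrase, word_succ]
  rcases lzUpdate_of_le rule D (lzRun rule D z j).dict (z ((lzRun rule D z j).pos +
    lzMatch rule D z j)) (m := word z (lzRun rule D z j).pos (lzMatch rule D z j))
    (by simpa using h) with he | he <;>
  · rw [he, List.take_take, min_eq_left hD]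
    simp

lemma lzPhrase_mem_take {j : ℕ} (h : lzMatch rule D z j + 1 ≤ Nat.log 2 D ^ 2) (i : ℕ)
    (hi : 2 * i + 1 ≤ D) :
    lzPhrase rule D z j ∈ (lzRun rule D z (j + 1 + i)).dict.take (2 * i + 1) := by
  induction i with
  | zero => exact lzPhrase_mem_take_succ rule D z (by omega) h
  | succ i ih =>
    rw [← add_assoc, lzRun_succ_dict]
    exact mem_take_lzUpdate rule (ih (by omega)) (by omega)

/-- Two equal phrases that enter the dictionary are at least `D / 2` phrases apart, under both
conventions for what counts as a use. -/
lemma half_le_of_lzPhrase_eq {j j' : ℕ} (hj : j < j')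
    (h : lzMatch rule D z j + 1 ≤ Nat.log 2 D ^ 2) (he : lzPhrase rule D z j = lzPhrase rule D z j') :
    D / 2 ≤ j' - j := by
  by_contra! hlt
  have h1 := lzPhrase_mem_take rule D z h (j' - j - 1) (by omega)
  rw [show j + 1 + (j' - j - 1) = j' by omega, he] at h1
  exact lzPhrase_not_mem rule D z j' (List.mem_of_mem_take h1)

end Recency

/-! ### Binary codes for finite codebooks -/

section Codebook

lemma natCast_size_le {n : ℕ} {X : ℝ} (hX : 1 ≤ X) (h : (n : ℝ) ≤ X) :
    (Nat.size n : ℝ) ≤ 1 + Real.logb 2 X := by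
  have h0 : 0 ≤ Real.logb 2 X := Real.logb_nonneg (by norm_num) hX
  rcases hs : Nat.size n with _ | k
  · push_cast; linarith
  · have h1 : 2 ^ k ≤ n := Nat.lt_size.1 (by omega)
    have h2 : (k : ℝ) ≤ Real.logb 2 X := by
      rw [Real.le_logb_iff_rpow_le (by norm_num) (by linarith), Real.rpow_natCast]
      exact le_trans (by exact_mod_cast h1) h
    push_cast
    linarith

/-- The elements of a finite type, sorted by a cost `ℓ`, can be numbered in binary: the word for `v`
is then no longer than the binary expansion of the number of elements that are not costlier. -/
lemma exists_injective_code {V α : Type*} [Fintype V] [LinearOrder α] (ℓ : V → α) :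
    ∃ e : V → List Bool, Function.Injective e ∧
      ∀ v, (e v).length ≤ Nat.size (Finset.univ.filter fun v' => ℓ v' ≤ ℓ v).card := by
  classical
  let key : V → α ×ₗ Fin (Fintype.card V) := fun v => toLex (ℓ v, Fintype.equivFin V v)
  have hkey : Function.Injective key := fun v w h => by
    have := congrArg Prod.snd (toLex.injective h)
    exact (Fintype.equivFin V).injective this
  let r : V → ℕ := fun v => (Finset.univ.filter fun v' => key v' < key v).card
  have hlt : ∀ v w, key v < key w → r v < r w := fun v w h => by
    refine Finset.card_lt_card ⟨fun u hu => ?_, fun hsub => ?_⟩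
    · simp only [Finset.mem_filter, Finset.mem_univ, true_and] at hu ⊢
      exact hu.trans h
    · have := hsub (Finset.mem_filter.2 ⟨Finset.mem_univ v, h⟩)
      simp at this
  refine ⟨fun v => Nat.bits (r v), fun v w h => ?_, fun v => ?_⟩
  · have hr : r v = r w := Nat.eq_of_testBit_eq fun i => by
      rw [Nat.testBit_eq_inth, Nat.testBit_eq_inth]; exact congrArg (fun l => List.getI l i) h
    rcases lt_trichotomy (key v) (key w) with h1 | h1 | h1
    · exact absurd hr (hlt v w h1).ne
    · exact hkey h1
    · exact absurd hr (hlt w v h1).ne'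
  · refine (Nat.size_eq_bits_len (r v)).le.trans ?_
    refine Nat.size_le_size (Finset.card_le_card fun u hu => ?_)
    simp only [Finset.mem_filter, Finset.mem_univ, true_and] at hu ⊢
    rcases Prod.Lex.lt_iff.1 hu with h | h
    · exact le_of_lt h
    · exact le_of_eq h.1

/-- A family of codebooks `S j` with at most `C * T ^ j` vectors each gives an encoder that spends
about `j * log T` bits on a vector that has a reproduction in `S j`. -/
lemma FSLDFinite_le_of_codebooks {A : Type*} [Fintype A] (hA : 2 ≤ Fintype.card A)
    {d : (n : ℕ) → (Fin n → A) → (Fin n → A) → ℝ} {dmax : ℝ} {x : ℕ → A} {s L c C T : ℕ}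
    (hrep : ∀ u : Fin L → A, ∃ v : Fin L → A, d L u v ≤ L * dmax) (hs : 1 ≤ s) (hC : 1 ≤ C)
    (hT : 2 ≤ T) (S : ℕ → Set (Fin L → A)) (hS : ∀ j, (S j).ncard ≤ C * T ^ j) (j : ℕ → ℕ)
    (hcov : ∀ m, ∃ v ∈ S (j m), d L (block x L m) v ≤ L * dmax) :
    FSLDFinite d dmax s L c x ≤
      (((∑ m ∈ Finset.range c, (1 + Real.logb 2 (C * T) + j m * Real.logb 2 T)) /
        (((c * L : ℕ) : ℝ) * Real.logb 2 (Fintype.card A)) : ℝ) : EReal) := by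
  classical
  have : Nonempty A := Fintype.card_pos_iff.1 (by omega)
  have : NeZero s := ⟨by omega⟩
  let ℓ : (Fin L → A) → WithTop ℕ := fun v =>
    if h : ∃ i, v ∈ S i then ((Nat.find h : ℕ) : WithTop ℕ) else ⊤
  have hℓ : ∀ v i, v ∈ S i → ℓ v ≤ (i : WithTop ℕ) := fun v i h => by
    have hex : ∃ i, v ∈ S i := ⟨i, h⟩
    simp only [ℓ, dif_pos hex]
    exact_mod_cast Nat.find_min' hex h
  have hℓ' : ∀ v (i : ℕ), ℓ v ≤ (i : WithTop ℕ) → ∃ k ∈ Finset.range (i + 1), v ∈ S k := by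
    intro v i h
    by_cases hex : ∃ i, v ∈ S i
    · simp only [ℓ, dif_pos hex] at h
      have h2 : Nat.find hex ≤ i := by exact_mod_cast h
      exact ⟨_, Finset.mem_range.2 (by omega), Nat.find_spec hex⟩
    · simp [ℓ, dif_neg hex] at h
  obtain ⟨e, he, hlen⟩ := exists_injective_code ℓ
  have hcard : ∀ i : ℕ, (Finset.univ.filter fun v => ℓ v ≤ (i : WithTop ℕ)).card
      ≤ C * T ^ (i + 1) := fun i => by
    calc (Finset.univ.filter fun v => ℓ v ≤ (i : WithTop ℕ)).card
        ≤ ((Finset.range (i + 1)).biUnion fun k => (S k).toFinite.toFinset).card := by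
          refine Finset.card_le_card fun v hv => ?_
          obtain ⟨k, hk, hvk⟩ := hℓ' v i (Finset.mem_filter.1 hv).2
          exact Finset.mem_biUnion.2 ⟨k, hk, by simpa using hvk⟩
      _ ≤ ∑ k ∈ Finset.range (i + 1), ((S k).toFinite.toFinset).card := Finset.card_biUnion_le
      _ ≤ ∑ k ∈ Finset.range (i + 1), C * T ^ k := Finset.sum_le_sum fun k _ => by
          rw [← Set.ncard_eq_toFinset_card]; exact hS k
      _ ≤ C * T ^ (i + 1) := by
          rw [← Finset.mul_sum]
          exact Nat.mul_le_mul_left _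
            (Nat.geomSum_lt (s := Finset.range (i + 1)) hT (by simp)).le
  have hbest : ∀ u : Fin L → A, ∃ v, d L u v ≤ L * dmax ∧
      ∀ v', d L u v' ≤ L * dmax → ℓ v ≤ ℓ v' := fun u => by
    obtain ⟨v0, hv0⟩ := hrep u
    obtain ⟨v, hv, hmin⟩ := Finset.exists_min_image
      (Finset.univ.filter fun v => d L u v ≤ L * dmax) ℓ ⟨v0, by simpa using hv0⟩
    exact ⟨v, by simpa using hv, fun v' h => hmin v' (by simpa using h)⟩
  choose best hbest1 hbest2 using hbest
  let E : FSDLEncoder d dmax L s :=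
    { next := fun q _ => q
      out := fun _ u => e (best u)
      decode := fun _ _ w => Function.invFun e w
      distortion_le := fun q u => by
        rw [Function.leftInverse_invFun he]; exact hbest1 u }
  refine iInf_le_of_le E (iInf_le_of_le (0 : Fin s) ?_)
  have hq : (0 : ℝ) ≤ Real.logb 2 (Fintype.card A) :=
    Real.logb_nonneg (by norm_num) (by exact_mod_cast (by omega : 1 ≤ Fintype.card A))
  rw [EReal.coe_le_coe_iff]
  refine div_le_div_of_nonneg_right ?_ (by positivity)
  have hCR : (1 : ℝ) ≤ C := by exact_mod_cast hC
  have hTR : (1 : ℝ) ≤ T := by exact_mod_cast (by omega : 1 ≤ T)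
  rw [FSDLEncoder.bits, Nat.cast_sum]
  refine Finset.sum_le_sum fun m _ => ?_
  obtain ⟨v, hv, hd⟩ := hcov m
  have h1 : ℓ (best (block x L m)) ≤ (j m : WithTop ℕ) :=
    (hbest2 _ v hd).trans (hℓ v _ hv)
  have h2 : (Finset.univ.filter fun v' => ℓ v' ≤ ℓ (best (block x L m))).card
      ≤ C * T ^ (j m + 1) :=
    (Finset.card_le_card fun u hu => by
      simp only [Finset.mem_filter, Finset.mem_univ, true_and] at hu ⊢
      exact hu.trans h1).trans (hcard (j m))
  have h3 := natCast_size_le (X := C * T * T ^ j m)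
    (one_le_mul_of_one_le_of_one_le (one_le_mul_of_one_le_of_one_le hCR hTR) (one_le_pow₀ hTR))
    (by rw [mul_assoc, ← pow_succ']; exact_mod_cast h2)
  rw [Real.logb_mul (by positivity) (by positivity), Real.logb_pow] at h3
  have h4 : ((e (best (block x L m))).length : ℝ) ≤ _ := Nat.cast_le.2 (hlen (best (block x L m)))
  show ((e (best (block x L m))).length : ℝ) ≤ _
  linarith

end Codebook

/-! ### Decoding LZ78(LRU) -/

section Decoding

variable {B : Type*}

/-- The decoder of LZ78(LRU): each token names a dictionary entry (or none), to be copied, and the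
letter that follows it. -/
noncomputable def lzDecode (rule : UseRule) (D Lmax : ℕ) :
    List (List B) → List (Option (Fin D) × B) → List B
  | _, [] => []
  | dict, t :: ts =>
    (t.1.elim [] fun i => dict.getD i []) ++ [t.2] ++
      lzDecode rule D Lmax (lzUpdate rule D Lmax dict (t.1.elim [] fun i => dict.getD i []) t.2) ts

variable (rule : UseRule) (D : ℕ) (z : ℕ → B)

lemma exists_lzDecode_eq (n j : ℕ) : ∃ ts : List (Option (Fin D) × B), ts.length = n ∧
    lzDecode rule D (Nat.log 2 D ^ 2) (lzRun rule D z j).dict ts =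
      word z (lzRun rule D z j).pos ((lzRun rule D z (j + n)).pos - (lzRun rule D z j).pos) := by
  induction n generalizing j with
  | zero => exact ⟨[], rfl, by simp [lzDecode, word]⟩
  | succ n ih =>
    obtain ⟨ts, hts, he⟩ := ih (j + 1)
    have hi : ∃ o : Option (Fin D), (o.elim [] fun i => (lzRun rule D z j).dict.getD i []) =
        word z (lzRun rule D z j).pos (lzMatch rule D z j) := by
      by_cases h : lzMatch rule D z j = 0
      · exact ⟨none, by simp [h, word]⟩
      · obtain ⟨i, hi, heq⟩ := List.mem_iff_getElem.1 (word_matchLength_mem z h)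
        refine ⟨some ⟨i, hi.trans_le (length_lzRun_dict_le rule D z j)⟩, ?_⟩
        simp only [Option.elim_some, List.getD_eq_getElem _ _ hi]
        exact heq
    obtain ⟨o, ho⟩ := hi
    refine ⟨(o, z ((lzRun rule D z j).pos + lzMatch rule D z j)) :: ts, by simp [hts], ?_⟩
    rw [lzDecode, ho, ← lzRun_succ_dict, he, ← word_succ, lzRun_succ_pos, word_append]
    have h1 := (lzRun_pos_strictMono rule D z).monotone (show j + 1 ≤ j + 1 + n by omega)
    simp only [lzRun_succ_pos] at h1
    rw [show j + (n + 1) = j + 1 + n by ring]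
    congr 1
    omega

/-- The words of length at most `l`. -/
def ShortWord (B : Type*) (l : ℕ) : Set (List B) := {w | w.length ≤ l}

lemma finite_shortWord (B : Type*) [Finite B] (l : ℕ) : (ShortWord B l).Finite :=
  List.finite_length_le B l

/-- The dictionaries with at most `D` phrases of at most `l` letters each. -/
def Dictionary (B : Type*) (D l : ℕ) : Set (List (List B)) :=
  {dict | dict.length ≤ D ∧ ∀ u ∈ dict, u.length ≤ l}

lemma finite_dictionary (B : Type*) [Finite B] (D l : ℕ) : (Dictionary B D l).Finite := by
  have : Finite (ShortWord B l) := finite_shortWord B l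
  refine ((List.finite_length_le (ShortWord B l) D).image (List.map Subtype.val)).subset ?_
  rintro dict ⟨h1, h2⟩
  refine ⟨dict.attach.map fun u => ⟨u.1, h2 u.1 u.2⟩, by simpa using h1, ?_⟩
  simp

/-- From position `i` of the input on, the decoder can be started with a dictionary of admissible
size after a raw word of at most one phrase length, and then it needs one token for each phrase that
starts in the part to be reproduced. -/
lemma exists_raw_append_lzDecode {i i' : ℕ} (h : i ≤ i') :
    ∃ raw ∈ ShortWord B (Nat.log 2 D ^ 2), ∃ dict ∈ Dictionary B D (Nat.log 2 D ^ 2),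
    ∃ ts : List (Option (Fin D) × B), ts.length = lzPhrases rule D z i' - lzPhrases rule D z i ∧
    ∃ l, i' ≤ i + l ∧ raw ++ lzDecode rule D (Nat.log 2 D ^ 2) dict ts = word z i l := by
  have hJ := lzPhrases_mono rule D z h
  obtain ⟨ts, hts, he⟩ := exists_lzDecode_eq rule D z
    (lzPhrases rule D z i' - lzPhrases rule D z i) (lzPhrases rule D z i)
  have h1 := le_lzRun_pos_lzPhrases rule D z i
  have h2 := le_lzRun_pos_lzPhrases rule D z i'
  have h3 := lzRun_pos_lzPhrases_le rule D z i
  have h4 := (lzRun_pos_strictMono rule D z).monotone hJ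
  rw [Nat.add_sub_cancel' hJ] at he
  refine ⟨word z i ((lzRun rule D z (lzPhrases rule D z i)).pos - i), ?_,
    (lzRun rule D z (lzPhrases rule D z i)).dict,
    ⟨length_lzRun_dict_le rule D z _, length_le_of_mem_lzRun_dict rule D z _⟩, ts, hts,
    (lzRun rule D z (lzPhrases rule D z i')).pos - i, by omega, ?_⟩
  · simp only [ShortWord, Set.mem_ofPred_eq, length_word]
    omega
  · rw [he]
    have := word_append z i ((lzRun rule D z (lzPhrases rule D z i)).pos - i)
      ((lzRun rule D z (lzPhrases rule D z i')).pos - (lzRun rule D z (lzPhrases rule D z i)).pos)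
    rw [Nat.add_sub_cancel' h1] at this
    rw [this]
    congr 1
    omega

end Decoding

/-! ### Reproductions assembled from pieces -/

section Gluing

variable {A : Type*} (d : (n : ℕ) → (Fin n → A) → (Fin n → A) → ℝ) (dmax : ℝ)

/-- On the `n` letters from position `p` on, `y` reproduces `x` within the allowed distortion.
Nothing is required of an empty stretch, on which the distortion measure is unconstrained. -/
def CoversFrom (x y : ℕ → A) (p n : ℕ) : Prop :=
  1 ≤ n → d n (fun i => x (p + i)) (fun i => y (p + i)) ≤ n * dmax

variable {d dmax}

lemma CoversFrom.add (hsub : SubadditiveDistortion d) {x y : ℕ → A} {p n k : ℕ}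
    (h1 : CoversFrom d dmax x y p n) (h2 : CoversFrom d dmax x y (p + n) k) :
    CoversFrom d dmax x y p (n + k) := by
  intro hnk
  rcases Nat.eq_zero_or_pos n with rfl | hn
  · have h3 := h2 (by omega)
    rw [add_zero] at h3
    rwa [zero_add]
  rcases Nat.eq_zero_or_pos k with rfl | hk
  · exact h1 hn
  have happ : ∀ w : ℕ → A, (fun i : Fin (n + k) => w (p + i)) =
      Fin.append (fun i : Fin n => w (p + i)) (fun i : Fin k => w (p + n + i)) := fun w => by
    ext i
    refine Fin.addCases (fun i => ?_) (fun i => ?_) i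
    · simp
    · simp [add_assoc]
  rw [happ x, happ y]
  refine (hsub n k hn hk _ _ _ _).trans ((add_le_add (h1 hn) (h2 hk)).trans (le_of_eq ?_))
  push_cast
  ring

lemma CoversFrom.mul (hsub : SubadditiveDistortion d) {x y : ℕ → A} {p L n : ℕ}
    (h : ∀ k < n, CoversFrom d dmax x y (p + k * L) L) : CoversFrom d dmax x y p (n * L) := by
  induction n with
  | zero => intro h0; simp at h0
  | succ n ih =>
    rw [Nat.succ_mul]
    exact CoversFrom.add hsub (ih fun k hk => h k (by omega)) (h n (by omega))

lemma exists_covering_piece (hrep : AdmitsReproduction d dmax) [Nonempty A] {L n : ℕ} (hn : n ≤ L)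
    (x : ℕ → A) (p : ℕ) : ∃ w : Fin L → A, ∀ y : ℕ → A,
      (∀ i : Fin L, (i : ℕ) < n → y (p + i) = w i) → CoversFrom d dmax x y p n := by
  rcases Nat.eq_zero_or_pos n with rfl | h0
  · exact ⟨fun _ => Classical.arbitrary A, fun y _ h => absurd h (by omega)⟩
  obtain ⟨v, hv⟩ := hrep n h0 (fun i => x (p + i))
  refine ⟨fun i => if h : (i : ℕ) < n then v ⟨i, h⟩ else Classical.arbitrary A, fun y hy _ => ?_⟩
  convert hv using 2
  ext i
  rw [hy ⟨i, i.2.trans_le hn⟩ i.2]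
  simp

/-- The word that consists of `e < L` letters of `pre`, then of `n` consecutive `L`-vectors `w k`,
and then of letters of `suf`. -/
def glue {L : ℕ} (hL : 0 < L) (e n : ℕ) (pre : Fin L → A) (w : ℕ → Fin L → A) (suf : Fin L → A)
    (i : ℕ) : A :=
  if i < e then pre ⟨i % L, Nat.mod_lt _ hL⟩
  else if (i - e) / L < n then w ((i - e) / L) ⟨(i - e) % L, Nat.mod_lt _ hL⟩
  else suf ⟨(i - e) % L, Nat.mod_lt _ hL⟩

lemma exists_glue_covers (hsub : SubadditiveDistortion d) (hrep : AdmitsReproduction d dmax)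
    [Nonempty A] {L : ℕ} (hL : 0 < L) (x : ℕ → A) {e n t i : ℕ} (he : e < L) (ht : t < L)
    (w : ℕ → Fin L → A) (hw : ∀ k < n, d L (block x L (i + k)) (w k) ≤ L * dmax) {p : ℕ}
    (hp : p + e = i * L) : ∃ pre suf : Fin L → A,
      CoversFrom d dmax (fun j => x (p + j)) (glue hL e n pre w suf) 0 (e + n * L + t) := by
  obtain ⟨pre, hpre⟩ := exists_covering_piece hrep he.le (fun j => x (p + j)) 0
  obtain ⟨suf, hsuf⟩ := exists_covering_piece hrep ht.le (fun j => x (p + j)) (0 + (e + n * L))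
  refine ⟨pre, suf, CoversFrom.add hsub (CoversFrom.add hsub ?_ ?_) ?_⟩
  · refine hpre _ fun j hj => ?_
    simp only [glue, zero_add, if_pos hj, Nat.mod_eq_of_lt j.2]
  · refine CoversFrom.mul hsub fun k hk _ => ?_
    convert hw k hk using 2
    · ext j
      simp only [block]
      congr 1
      rw [add_mul, ← hp]
      ring
    · ext j
      have h1 : 0 + e + k * L + (j : ℕ) - e = k * L + j := by omega
      have h2 : (k * L + (j : ℕ)) / L = k := by
        rw [add_comm, Nat.add_mul_div_right _ _ hL, Nat.div_eq_of_lt j.2, zero_add]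
      have h3 : (k * L + (j : ℕ)) % L = j := by
        rw [add_comm, Nat.add_mul_mod_self_right, Nat.mod_eq_of_lt j.2]
      simp only [glue, h1, h2, h3]
      rw [if_neg (by omega), if_pos hk]
  · refine hsuf _ fun j hj => ?_
    have h1 : 0 + (e + n * L) + (j : ℕ) - e = n * L + j := by omega
    have h2 : (n * L + (j : ℕ)) / L = n := by
      rw [add_comm, Nat.add_mul_div_right _ _ hL, Nat.div_eq_of_lt j.2, zero_add]
    have h3 : (n * L + (j : ℕ)) % L = j := by
      rw [add_comm, Nat.add_mul_mod_self_right, Nat.mod_eq_of_lt j.2]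
    simp only [glue, h1, h2, h3]
    rw [if_neg (by omega), if_neg (by omega)]

lemma glue_congr {L : ℕ} (hL : 0 < L) {e n : ℕ} {pre suf : Fin L → A} {w w' : ℕ → Fin L → A}
    (h : ∀ k < n, w k = w' k) : glue hL e n pre w suf = glue hL e n pre w' suf := by
  ext i
  unfold glue
  split_ifs with h1 h2
  · rfl
  · rw [h _ h2]
  · rfl

end Gluing

/-! ### The scheme does no better than finite-state encoders for long vectors -/

section LowerBound

variable {A : Type*}

/-- What the decoder has to know about an `L'`-vector besides the tokens: the offset of the first
boundary of `L`-vectors, the letters before the first and after the last such boundary, the letters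
before the first phrase, and the dictionary at that point. There are only finitely many values,
independently of `L'`. -/
abbrev StartData (A : Type*) (L D l : ℕ) : Type _ :=
  Fin L × (Fin L → A) × (Fin L → A) × ShortWord (Fin L → A) l × Dictionary (Fin L → A) D l

/-- The `L'`-vectors that are described by the start data together with `j` tokens. -/
noncomputable def lzCodebook (A : Type*) (rule : UseRule) (D L' : ℕ) {L : ℕ} (hL : 0 < L) (j : ℕ) :
    Set (Fin L' → A) :=
  Set.range fun (p : StartData A L D (Nat.log 2 D ^ 2) ×
      (Fin j → Option (Fin D) × (Fin L → A))) (i : Fin L') =>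
    glue hL p.1.1 ((L' - p.1.1) / L) p.1.2.1
      (fun k => (p.1.2.2.2.1.1 ++
        lzDecode rule D (Nat.log 2 D ^ 2) p.1.2.2.2.2.1 (List.ofFn p.2)).getD k p.1.2.1)
      p.1.2.2.1 i

lemma ncard_lzCodebook_le [Fintype A] (rule : UseRule) (D L' : ℕ) {L : ℕ} (hL : 0 < L) (j : ℕ) :
    (lzCodebook A rule D L' hL j).ncard ≤
      Nat.card (StartData A L D (Nat.log 2 D ^ 2)) * ((D + 1) * Fintype.card A ^ L) ^ j := by
  have : Finite (ShortWord (Fin L → A) (Nat.log 2 D ^ 2)) := finite_shortWord _ _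
  have : Finite (Dictionary (Fin L → A) D (Nat.log 2 D ^ 2)) := finite_dictionary _ _ _
  rw [lzCodebook, ← Nat.card_coe_set_eq]
  refine (Finite.card_range_le _).trans (le_of_eq ?_)
  simp [Nat.card_prod]

variable {d : (n : ℕ) → (Fin n → A) → (Fin n → A) → ℝ} {dmax : ℝ}

/-- The index of the first `L`-vector that starts at or after position `a`. -/
def firstBlock (L a : ℕ) : ℕ := (a + (L - 1)) / L

lemma exists_mem_lzCodebook [Nonempty A] (hsub : SubadditiveDistortion d)
    (hrep : AdmitsReproduction d dmax) (x : ℕ → A) (rule : UseRule) (D : ℕ) {L L' : ℕ} (hL : 0 < L)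
    (hLL : L ≤ L') (z : ℕ → Fin L → A) (hz : ∀ m, d L (block x L m) (z m) ≤ L * dmax) (m : ℕ) :
    ∃ v ∈ lzCodebook A rule D L' hL (lzPhrases rule D z (firstBlock L (m * L' + L')) -
      lzPhrases rule D z (firstBlock L (m * L'))), d L' (block x L' m) v ≤ L' * dmax := by
  set a := m * L' with ha
  set i₀ := firstBlock L a with hi₀
  set i₁ := firstBlock L (a + L') with hi₁
  have h0 : a ≤ i₀ * L ∧ i₀ * L < a + L := by
    have h1 := Nat.div_add_mod (a + (L - 1)) L
    have h2 := Nat.mod_lt (a + (L - 1)) hL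
    rw [mul_comm] at h1
    rw [hi₀, firstBlock]
    omega
  have h1 : a + L' ≤ i₁ * L := by
    have h1 := Nat.div_add_mod (a + L' + (L - 1)) L
    have h2 := Nat.mod_lt (a + L' + (L - 1)) hL
    rw [mul_comm] at h1
    rw [hi₁, firstBlock]
    omega
  obtain ⟨e, he⟩ : ∃ e, a + e = i₀ * L := ⟨i₀ * L - a, by omega⟩
  have heL : e < L := by omega
  clear_value i₀ i₁
  obtain ⟨n, hn⟩ : ∃ n, (L' - e) / L = n := ⟨_, rfl⟩
  have hdm := Nat.div_add_mod (L' - e) L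
  have ht := Nat.mod_lt (L' - e) hL
  rw [mul_comm, hn] at hdm
  have hin : i₀ + n ≤ i₁ := by
    by_contra! hlt
    have : (i₁ + 1) * L ≤ (i₀ + n) * L := Nat.mul_le_mul_right _ hlt
    rw [add_mul, add_mul, ← he] at this
    omega
  obtain ⟨raw, hraw, dict, hdict, ts, hts, l, hl, hword⟩ :=
    exists_raw_append_lzDecode rule D z (show i₀ ≤ i₁ by omega)
  obtain ⟨pre, suf, hcov⟩ := exists_glue_covers hsub hrep hL x heL ht (n := n)
    (fun k => z (i₀ + k)) (fun k _ => hz (i₀ + k)) he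
  refine ⟨_, ⟨(⟨⟨e, heL⟩, pre, suf, ⟨raw, hraw⟩, ⟨dict, hdict⟩⟩, fun k => ts.get (k.cast hts.symm)),
    rfl⟩, ?_⟩
  have hofFn : List.ofFn (fun k => ts.get (k.cast hts.symm)) = ts := by
    refine List.ext_get (by simp [hts]) fun k hk hk' => by simp
  simp only [hofFn, hword]
  rw [hn, glue_congr hL (w' := fun k => z (i₀ + k)) fun k hk => ?_]
  · have := hcov (by omega)
    rw [show e + n * L + (L' - e) % L = L' by omega] at this
    have hb : block x L' m = fun i : Fin L' => x (a + i) := rfl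
    simpa [hb] using this
  · rw [List.getD_eq_getElem _ _ (by rw [length_word]; omega)]
    simp [word]

/-- Up to a term that vanishes as `L'` grows, the best finite-state encoder for `L'`-vectors is as
good as the scheme with any other vector length `L`. -/
lemma FSLDFinite_le_lzBits [Fintype A] (hA : 2 ≤ Fintype.card A) (hsub : SubadditiveDistortion d)
    (hrep : AdmitsReproduction d dmax) (x : ℕ → A) (rule : UseRule) {D L M : ℕ} (hD : 1 ≤ D)
    (hL : 0 < L) (hM : 0 < M) (z : ℕ → Fin L → A)
    (hz : ∀ m, d L (block x L m) (z m) ≤ L * dmax) :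
    ∃ C : ℝ, ∀ s L' c : ℕ, 1 ≤ s → L ≤ L' → 1 ≤ c →
      FSLDFinite d dmax s L' c x ≤
        ((lzBits rule D z (c * L' / (M * L) * M) /
          (((c * L' : ℕ) : ℝ) * Real.logb 2 (Fintype.card A)) + C / L' : ℝ) : EReal) := by
  have : Nonempty A := Fintype.card_pos_iff.1 (by omega)
  set q := Fintype.card A with hq
  set β := Real.logb 2 D + 1 + Real.logb 2 (Fintype.card (Fin L → A)) with hβ
  set T := (D + 1) * q ^ L with hT
  set C₀ := Nat.card (StartData A L D (Nat.log 2 D ^ 2)) with hC₀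
  have : Finite (ShortWord (Fin L → A) (Nat.log 2 D ^ 2)) := finite_shortWord _ _
  have : Finite (Dictionary (Fin L → A) D (Nat.log 2 D ^ 2)) := finite_dictionary _ _ _
  have : Nonempty (StartData A L D (Nat.log 2 D ^ 2)) :=
    ⟨⟨⟨0, hL⟩, fun _ => Classical.arbitrary A, fun _ => Classical.arbitrary A,
      ⟨[], by simp [ShortWord]⟩, ⟨[], by simp [Dictionary]⟩⟩⟩
  have hC₀1 : 1 ≤ C₀ := Nat.card_pos
  have hqL : 1 ≤ q ^ L := Nat.one_le_pow _ _ (by omega)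
  have hT2 : 2 ≤ T := by
    rw [hT]
    calc 2 ≤ (D + 1) * 1 := by omega
      _ ≤ _ := Nat.mul_le_mul_left _ hqL
  have hlogT : Real.logb 2 T ≤ β := by
    have hDR : (1 : ℝ) ≤ D := by exact_mod_cast hD
    have hqR : (0 : ℝ) < (q : ℝ) ^ L := by exact_mod_cast hqL
    have h1 : (T : ℝ) ≤ D * 2 * (q : ℝ) ^ L := by
      rw [hT]
      push_cast
      gcongr
      linarith
    have h2 : β = Real.logb 2 (D * 2 * (q : ℝ) ^ L) := by
      rw [Real.logb_mul (by positivity) (by positivity), Real.logb_mul (by positivity) (by norm_num),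
        Real.logb_self_eq_one (by norm_num), hβ]
      simp [hq]
    rw [h2]
    exact Real.logb_le_logb_of_le (by norm_num) (by exact_mod_cast (by omega : 0 < T)) h1
  have hlogq : 1 ≤ Real.logb 2 q := by
    rw [Real.le_logb_iff_rpow_le (by norm_num) (by exact_mod_cast (by omega : 0 < q)),
      Real.rpow_one]
    exact_mod_cast hA
  have hlogT0 : 0 ≤ Real.logb 2 T :=
    Real.logb_nonneg (by norm_num) (by exact_mod_cast (by omega : 1 ≤ T))
  set C₁ := 1 + Real.logb 2 (C₀ * T) with hC₁
  have hC₁0 : 0 ≤ C₁ := by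
    have : 0 ≤ Real.logb 2 (C₀ * T) := Real.logb_nonneg (by norm_num)
      (by exact_mod_cast Nat.one_le_iff_ne_zero.2 (Nat.mul_ne_zero (by omega) (by omega)))
    linarith
  refine ⟨C₁ + β * (M + 1), fun s L' c hs hLL hc => ?_⟩
  have hL' : 1 ≤ L' := by omega
  refine (FSLDFinite_le_of_codebooks hA (hrep L' hL') hs hC₀1 hT2 (lzCodebook A rule D L' hL)
    (ncard_lzCodebook_le rule D L' hL) _
    (exists_mem_lzCodebook hsub hrep x rule D hL hLL z hz)).trans ?_
  rw [EReal.coe_le_coe_iff]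
  set K := c * L' / (M * L) with hK
  -- The phrase counts of consecutive vectors telescope.
  have htel : ∑ m ∈ Finset.range c, (lzPhrases rule D z (firstBlock L (m * L' + L')) -
      lzPhrases rule D z (firstBlock L (m * L'))) ≤ lzPhrases rule D z (K * M) + (M + 1) := by
    have hmono : Monotone fun m => lzPhrases rule D z (firstBlock L (m * L')) := fun m m' h =>
      lzPhrases_mono rule D z (Nat.div_le_div_right (by gcongr))
    have h1 := Finset.sum_range_tsub hmono c
    simp only [Nat.succ_mul] at h1
    rw [h1]
    refine (Nat.sub_le _ _).trans (le_trans ?_ (lzPhrases_add_le rule D z (K * M) (M + 1)))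
    refine lzPhrases_mono rule D z ?_
    have h2 : c * L' < (K + 1) * (M * L) := Nat.lt_mul_of_div_lt (Nat.lt_succ_self _)
      (Nat.mul_pos hM hL)
    have h3 : c * L' / L < K * M + M := by
      rw [Nat.div_lt_iff_lt_mul hL]
      calc _ < _ := h2
        _ = _ := by ring
    have h4 : firstBlock L (c * L') ≤ c * L' / L + 1 := by
      rw [firstBlock, ← Nat.add_div_right _ hL]
      exact Nat.div_le_div_right (by omega)
    omega
  have htelR : (∑ m ∈ Finset.range c, (((lzPhrases rule D z (firstBlock L (m * L' + L')) -
      lzPhrases rule D z (firstBlock L (m * L')) : ℕ)) : ℝ)) ≤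
      lzPhrases rule D z (K * M) + (M + 1) := by exact_mod_cast htel
  have hcR : (1 : ℝ) ≤ c := by exact_mod_cast hc
  have hLR : (1 : ℝ) ≤ L' := by exact_mod_cast hL'
  have hβ0 : 0 ≤ β := hlogT0.trans hlogT
  have hnum : ∑ m ∈ Finset.range c, (1 + Real.logb 2 (C₀ * T) +
      ((lzPhrases rule D z (firstBlock L (m * L' + L')) -
      lzPhrases rule D z (firstBlock L (m * L')) : ℕ) : ℝ) * Real.logb 2 T) ≤
      lzBits rule D z (K * M) + c * (C₁ + β * (M + 1)) := by
    rw [Finset.sum_add_distrib, ← Finset.sum_mul, Finset.sum_const, Finset.card_range,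
      nsmul_eq_mul, ← hC₁, lzBits, ← hβ]
    have h1 := mul_le_mul htelR hlogT hlogT0 (by positivity)
    have h2 : 0 ≤ (c - 1 : ℝ) * (β * (M + 1)) := mul_nonneg (by linarith) (by positivity)
    nlinarith
  have hden : 0 < ((c * L' : ℕ) : ℝ) * Real.logb 2 q := by
    push_cast
    positivity
  rw [div_le_iff₀ hden, add_mul, div_mul_cancel₀ _ hden.ne']
  refine hnum.trans (add_le_add le_rfl ?_)
  have h5 : (C₁ + β * (M + 1)) / L' * (((c * L' : ℕ) : ℝ) * Real.logb 2 q) =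
      c * (C₁ + β * (M + 1)) * Real.logb 2 q := by
    push_cast
    field_simp
  rw [h5]
  exact le_mul_of_one_le_right (by positivity) hlogq

/-- The compressibility is at most the compression ratio of the scheme, for every `L ≥ 1`. -/
lemma FSLD_le_schemeRatio [Fintype A] (hA : 2 ≤ Fintype.card A) (hsub : SubadditiveDistortion d)
    (hrep : AdmitsReproduction d dmax) (x : ℕ → A) (rule : UseRule) {L N : ℕ}
    (hL : 0 < L) (hN : 0 < N) (hLN : L ∣ N) (z : ℕ → Fin L → A)
    (hz : ∀ m, d L (block x L m) (z m) ≤ L * dmax) :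
    FSLD d dmax x ≤ schemeRatio rule L N z := by
  obtain ⟨M, rfl⟩ := hLN
  have hM : 0 < M := Nat.pos_of_mul_pos_left hN
  obtain ⟨C, hC⟩ := FSLDFinite_le_lzBits hA hsub hrep x rule (D := dictSize L)
    (Nat.one_le_two_pow) hL hM z hz
  refine EReal.le_of_forall_lt_iff_le.1 fun r hr => ?_
  have hq : 0 < Real.logb 2 (Fintype.card A) :=
    Real.logb_pos (by norm_num) (by exact_mod_cast (by omega : 1 < Fintype.card A))
  have hK := eventually_lt_of_limsup_lt hr
  refine limsup_le_of_le (h := (eventually_ge_atTop 1).mono fun s hs => ?_)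
  have hlim : Tendsto (fun L' : ℕ => ((r + C / L' : ℝ) : EReal)) atTop (𝓝 (r : EReal)) := by
    have := (tendsto_const_div_atTop_nhds_zero_nat C).const_add r
    rw [add_zero] at this
    exact (continuous_coe_real_ereal.tendsto r).comp this
  rw [← hlim.limsup_eq]
  refine limsup_le_limsup ((eventually_ge_atTop L).mono fun L' hL' => ?_)
  refine limsup_le_of_le (h := ?_)
  have hdiv : Tendsto (fun c : ℕ => c * L' / (M * L)) atTop atTop := by
    refine (Nat.tendsto_div_const_atTop (Nat.mul_pos hM hL).ne').comp ?_
    exact tendsto_id.atTop_mul_const' (by omega)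
  filter_upwards [hdiv.eventually hK, eventually_ge_atTop 1, hdiv.eventually_ge_atTop 1]
    with c hc hc1 hK1
  refine (hC s L' c hs hL' hc1).trans ?_
  rw [EReal.coe_le_coe_iff]
  rw [EReal.coe_lt_coe_iff, Nat.mul_div_cancel_left M hL, mul_comm L M] at hc
  refine add_le_add (le_trans ?_ hc.le) le_rfl
  have h1 : 0 < c * L' / (M * L) * (M * L) := Nat.mul_pos hK1 (Nat.mul_pos hM hL)
  have h2 : c * L' / (M * L) * (M * L) ≤ c * L' := Nat.div_mul_le_self _ _
  refine div_le_div_of_nonneg_left ?_ (mul_pos (by exact_mod_cast h1) hq) ?_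
  · have h3 : 0 ≤ Real.logb 2 (dictSize L) :=
      Real.logb_nonneg (by norm_num) (by exact_mod_cast Nat.one_le_two_pow)
    have : Nonempty A := Fintype.card_pos_iff.1 (by omega)
    have h4 : 0 ≤ Real.logb 2 (Fintype.card (Fin L → A)) :=
      Real.logb_nonneg (by norm_num) (by exact_mod_cast Fintype.card_pos)
    unfold lzBits
    positivity
  · exact mul_le_mul_of_nonneg_right (by exact_mod_cast h2) hq.le

end LowerBound

/-! ### The greedy quantizer and the entropy of its output -/

section Greedy

variable {A : Type*} {d : (n : ℕ) → (Fin n → A) → (Fin n → A) → ℝ} {dmax : ℝ}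

lemma mem_unreplaced {L M : ℕ} {B : Fin M → Fin L → A} {z : ℕ → Fin L → A} {i : ℕ} {m : Fin M} :
    m ∈ unreplaced d dmax B z i ↔ ∀ j < i, ¬ d L (B m) (z j) ≤ L * dmax := by
  simp [unreplaced]

lemma exists_isGreedyQuantization [Finite A] [Nonempty A] {L M : ℕ}
    (hcov : ∀ u : Fin L → A, ∃ v : Fin L → A, d L u v ≤ L * dmax) (B : Fin M → Fin L → A) :
    ∃ Q, IsGreedyQuantization d dmax B Q := by
  classical
  have hpick : ∀ R : Finset (Fin M), ∃ v, ∀ w, coverCount d dmax B R w ≤ coverCount d dmax B R v :=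
    fun R => Finite.exists_max _
  choose pick hpick using hpick
  let R : ℕ → Finset (Fin M) := fun i =>
    Nat.rec Finset.univ (fun _ R => R.filter fun m => ¬ d L (B m) (pick R) ≤ L * dmax) i
  let z : ℕ → Fin L → A := fun i => pick (R i)
  have hR : ∀ i, unreplaced d dmax B z i = R i := fun i => by
    induction i with
    | zero => ext m; simp [mem_unreplaced, R]
    | succ i ih =>
      ext m
      rw [show R (i + 1) = (R i).filter fun m => ¬ d L (B m) (z i) ≤ L * dmax from rfl,
        Finset.mem_filter, ← ih, mem_unreplaced, mem_unreplaced, Nat.forall_lt_succ_right]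
  have hmax : ∀ (i : ℕ) (w : Fin L → A), coverCount d dmax B (unreplaced d dmax B z i) w ≤
      coverCount d dmax B (unreplaced d dmax B z i) (z i) := fun i w => by
    rw [hR]; exact hpick (R i) w
  have hex : ∀ m, ∃ i, d L (B m) (z i) ≤ L * dmax := by
    by_contra! hno
    obtain ⟨m, hm⟩ := hno
    obtain ⟨w, hw⟩ := hcov (B m)
    -- While `m` is unreplaced, every step replaces at least one vector.
    have hdec : ∀ i, (unreplaced d dmax B z i).card + i ≤ M := fun i => by
      induction i with
      | zero => simpa using Finset.card_le_univ (unreplaced d dmax B z 0)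
      | succ i ih =>
        have h1 : 0 < coverCount d dmax B (unreplaced d dmax B z i) w :=
          Finset.card_pos.2 ⟨m, Finset.mem_filter.2
            ⟨mem_unreplaced.2 fun j _ => not_le.2 (hm j), hw⟩⟩
        obtain ⟨m', hm'⟩ := Finset.card_pos.1 (h1.trans_le (hmax i w))
        rw [Finset.mem_filter] at hm'
        have h2 : (unreplaced d dmax B z (i + 1)).card < (unreplaced d dmax B z i).card := by
          refine Finset.card_lt_card ⟨fun k hk => ?_, fun hsub => ?_⟩
          · exact mem_unreplaced.2 fun j hj => mem_unreplaced.1 hk j (by omega)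
          · exact mem_unreplaced.1 (hsub hm'.1) i (Nat.lt_succ_self i) hm'.2
        omega
    have := hdec (M + 1)
    omega
  refine ⟨fun m => z (Nat.find (hex m)), z, hmax, fun m => ⟨Nat.find (hex m), ?_,
    Nat.find_spec (hex m), rfl⟩⟩
  exact mem_unreplaced.2 fun j hj => Nat.find_min (hex m) hj

lemma IsGreedyQuantization.le {L M : ℕ} {B Q : Fin M → Fin L → A}
    (h : IsGreedyQuantization d dmax B Q) (m : Fin M) : d L (B m) (Q m) ≤ L * dmax := by
  obtain ⟨z, -, h⟩ := h
  obtain ⟨i, -, h1, h2⟩ := h m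
  rwa [h2]

lemma mul_log_sub_le_log_factorial (n : ℕ) :
    n * Real.log n - n ≤ Real.log (n.factorial) := by
  rcases Nat.eq_zero_or_pos n with rfl | hn
  · simp
  have h := Real.pow_div_factorial_le_exp (x := n) (by positivity) n
  have hn' : (0 : ℝ) < n := by exact_mod_cast hn
  have hf : (0 : ℝ) < n.factorial := by exact_mod_cast n.factorial_pos
  have h2 := Real.log_le_log (by positivity) h
  rw [Real.log_exp, Real.log_div (by positivity) hf.ne', Real.log_pow] at h2
  linarith

open Classical in
lemma factorial_card_le_prod {ι : Type*} (C : Finset ι) (f : ι → ℕ) :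
    C.card.factorial ≤ ∏ m ∈ C, (C.filter fun m' => f m ≤ f m').card := by
  induction hn : C.card generalizing C with
  | zero => simp [Finset.card_eq_zero.1 hn]
  | succ n ih =>
    obtain ⟨m₀, hm₀, hmin⟩ := Finset.exists_min_image C f (Finset.card_pos.1 (by omega))
    have hcard : (C.erase m₀).card = n := by rw [Finset.card_erase_of_mem hm₀, hn]; rfl
    rw [← Finset.mul_prod_erase C _ hm₀, Nat.factorial_succ,
      Finset.filter_true_of_mem fun m' hm' => hmin m' hm', hn]
    refine Nat.mul_le_mul_left _ ((ih _ hcard).trans (Finset.prod_le_prod' fun m _ => ?_))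
    exact Finset.card_le_card (Finset.filter_subset_filter _ (Finset.erase_subset _ _))

open Classical in
/-- The greedy quantizer is within one nat per vector of the minimum entropy: for any other way `κ`
of grouping vectors that have a common reproduction, order each group of size `c` by the times at
which its members are replaced. When its `i`-th last member is replaced, at least `i` unreplaced
vectors have a common reproduction, so the greedy class of that member has at least `i` elements, and
the product of these sizes over the group is at least `c! ≥ (c / e) ^ c`. -/
lemma IsGreedyQuantization.sum_log_card_ge {T : Type*} {L M : ℕ} {B Q : Fin M → Fin L → A}
    (h : IsGreedyQuantization d dmax B Q) (κ : Fin M → T)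
    (hκ : ∀ m, ∃ w, ∀ m', κ m' = κ m → d L (B m') w ≤ L * dmax) :
    ∑ m, Real.log (Finset.univ.filter fun m' => κ m' = κ m).card - M ≤
      ∑ m, Real.log (Finset.univ.filter fun m' => Q m' = Q m).card := by
  obtain ⟨z, hmax, hz⟩ := h
  choose τ hτ1 hτ2 hτ3 using hz
  have hrank : ∀ m, (Finset.univ.filter fun m' => κ m' = κ m ∧ τ m ≤ τ m').card ≤
      (Finset.univ.filter fun m' => Q m' = Q m).card := fun m => by
    obtain ⟨w, hw⟩ := hκ m
    calc (Finset.univ.filter fun m' => κ m' = κ m ∧ τ m ≤ τ m').card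
        ≤ coverCount d dmax B (unreplaced d dmax B z (τ m)) w := by
          refine Finset.card_le_card fun m' hm' => ?_
          rw [Finset.mem_filter] at hm' ⊢
          exact ⟨mem_unreplaced.2 fun j hj => mem_unreplaced.1 (hτ1 m') j (by omega),
            hw m' hm'.2.1⟩
      _ ≤ coverCount d dmax B (unreplaced d dmax B z (τ m)) (z (τ m)) := hmax _ _
      _ ≤ _ := by
          refine Finset.card_le_card fun m' hm' => ?_
          rw [Finset.mem_filter] at hm' ⊢
          have heq : τ m' = τ m := by
            rcases lt_trichotomy (τ m') (τ m) with h1 | h1 | h1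
            · exact absurd (hτ2 m') (mem_unreplaced.1 hm'.1 _ h1)
            · exact h1
            · exact absurd hm'.2 (mem_unreplaced.1 (hτ1 m') _ h1)
          exact ⟨Finset.mem_univ _, by rw [hτ3 m', hτ3 m, heq]⟩
  have hpos : ∀ m, 0 < (Finset.univ.filter fun m' => κ m' = κ m ∧ τ m ≤ τ m').card := fun m =>
    Finset.card_pos.2 ⟨m, by simp⟩
  refine le_trans ?_ (Finset.sum_le_sum fun m _ =>
    Real.log_le_log (by exact_mod_cast hpos m) (Nat.cast_le.2 (hrank m)))
  have hMsum : (M : ℝ) = ∑ t ∈ Finset.univ.image κ,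
      ((Finset.univ.filter fun m => κ m = t).card : ℝ) := by
    rw [← Nat.cast_sum, ← Finset.card_eq_sum_card_image, Finset.card_univ, Fintype.card_fin]
  rw [Finset.sum_comp (fun t => Real.log (Finset.univ.filter fun m' => κ m' = t).card) κ, hMsum,
    ← Finset.sum_sub_distrib,
    ← Finset.sum_fiberwise_of_maps_to (fun m _ => Finset.mem_image_of_mem κ (Finset.mem_univ m))
      fun m => Real.log (Finset.univ.filter fun m' => κ m' = κ m ∧ τ m ≤ τ m').card]
  refine Finset.sum_le_sum fun t _ => ?_
  rw [nsmul_eq_mul]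
  set C := Finset.univ.filter fun m => κ m = t with hC
  have hCeq : ∀ m ∈ C, (Finset.univ.filter fun m' => κ m' = κ m ∧ τ m ≤ τ m') =
      C.filter fun m' => τ m ≤ τ m' := fun m hm => by
    rw [hC, Finset.mem_filter] at hm
    rw [hC, Finset.filter_filter, hm.2]
  refine (mul_log_sub_le_log_factorial C.card).trans ?_
  rw [← Real.log_prod fun m _ => by exact_mod_cast (hpos m).ne']
  refine Real.log_le_log (by exact_mod_cast Nat.factorial_pos _) ?_
  rw [Finset.prod_congr rfl fun m hm => by rw [hCeq m hm]]
  exact_mod_cast factorial_card_le_prod C τ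

open Classical in
/-- Gibbs' inequality for the empirical distribution of `κ` and subprobability weights `W`. -/
lemma sum_log_card_div_le {ι T : Type*} [Fintype ι] (κ : ι → T) (W : T → ℝ) (hW : ∀ t, 0 < W t)
    (hsum : ∀ F : Finset T, ∑ t ∈ F, W t ≤ 1) :
    ∑ m : ι, (Real.log (Fintype.card ι) - Real.log (Finset.univ.filter fun m' => κ m' = κ m).card) ≤
      ∑ m, -Real.log (W (κ m)) := by
  set n : T → ℕ := fun t => (Finset.univ.filter fun m' => κ m' = t).card with hn
  have hpos : ∀ m, (0 : ℝ) < n (κ m) := fun m => by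
    exact_mod_cast Finset.card_pos.2 ⟨m, by simp⟩
  have h1 : ∀ m : ι, Real.log (Fintype.card ι) - Real.log (n (κ m)) + Real.log (W (κ m)) ≤
      (Fintype.card ι) * (W (κ m) / n (κ m)) - 1 := fun m => by
    have hM : (0 : ℝ) < Fintype.card ι := by exact_mod_cast Fintype.card_pos_iff.2 ⟨m⟩
    have hWm := hW (κ m)
    rw [← Real.log_div hM.ne' (hpos m).ne',
      ← Real.log_mul (div_pos hM (hpos m)).ne' hWm.ne',
      show (Fintype.card ι : ℝ) / n (κ m) * W (κ m) = Fintype.card ι * (W (κ m) / n (κ m)) by ring]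
    exact Real.log_le_sub_one_of_pos (mul_pos hM (div_pos hWm (hpos m)))
  have h2 : ∑ m, W (κ m) / n (κ m) = ∑ t ∈ Finset.univ.image κ, W t := by
    rw [Finset.sum_comp (fun t => W t / n t) κ]
    refine Finset.sum_congr rfl fun t ht => ?_
    obtain ⟨m, -, rfl⟩ := Finset.mem_image.1 ht
    rw [nsmul_eq_mul]
    exact mul_div_cancel₀ _ (hpos m).ne'
  have h3 := Finset.sum_le_sum fun m (_ : m ∈ (Finset.univ : Finset ι)) => h1 m
  rw [Finset.sum_add_distrib, Finset.sum_sub_distrib _ (fun _ => (1 : ℝ)), ← Finset.mul_sum, h2,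
    Finset.sum_const, Finset.card_univ, nsmul_eq_mul, mul_one] at h3
  rw [Finset.sum_neg_distrib]
  have h4 : (Fintype.card ι : ℝ) * ∑ t ∈ Finset.univ.image κ, W t ≤ Fintype.card ι * 1 := by
    gcongr
    exact hsum _
  linarith

end Greedy

/-! ### Product weights of words -/

section Words

variable {β : Type*} [Fintype β]

lemma sum_prod_map_le_pow (P : β → ℝ) (hP : ∀ b, 0 ≤ P b) (n : ℕ) (F : Finset (List β))
    (hF : ∀ w ∈ F, w.length = n) : ∑ w ∈ F, (w.map P).prod ≤ (∑ b, P b) ^ n := by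
  classical
  calc ∑ w ∈ F, (w.map P).prod
      ≤ ∑ w ∈ Finset.univ.image (List.ofFn : (Fin n → β) → List β), (w.map P).prod := by
        refine Finset.sum_le_sum_of_subset_of_nonneg (fun w hw => ?_) fun w _ _ => ?_
        · obtain rfl := hF w hw
          exact Finset.mem_image.2 ⟨w.get, Finset.mem_univ _, List.ofFn_get w⟩
        · refine List.prod_nonneg fun a ha => ?_
          obtain ⟨b, -, rfl⟩ := List.mem_map.1 ha
          exact hP b
    _ = ∑ p : Fin n → β, ∏ i, P (p i) := by
        rw [Finset.sum_image List.ofFn_injective.injOn]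
        refine Finset.sum_congr rfl fun p _ => ?_
        rw [List.map_ofFn, List.prod_ofFn]
        rfl
    _ = (∑ b, P b) ^ n := by
        rw [Finset.sum_pow', Fintype.piFinset_univ]

lemma sum_prod_map_le_sum_pow (P : β → ℝ) (hP : ∀ b, 0 ≤ P b) (F : Finset (List β)) :
    ∑ w ∈ F, (w.map P).prod ≤ ∑ n ∈ F.image List.length, (∑ b, P b) ^ n := by
  rw [← Finset.sum_fiberwise_of_maps_to (fun w hw => Finset.mem_image_of_mem List.length hw)]
  exact Finset.sum_le_sum fun n _ => sum_prod_map_le_pow P hP n _ fun w hw =>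
    (Finset.mem_filter.1 hw).2

/-- Kraft's inequality for one-to-one codes: since the words need not form a prefix code, the
weight `2 ^ (-|w|)` is damped by a factor `r ^ |w|`. -/
lemma sum_damped_kraft_le {r : ℝ} (hr0 : 0 ≤ r) (hr1 : r < 1) (F : Finset (List Bool)) :
    ∑ w ∈ F, (1 - r) * (r / 2) ^ w.length ≤ 1 := by
  have h1 := sum_prod_map_le_sum_pow (fun _ : Bool => r / 2) (fun _ => by positivity) F
  simp only [List.map_const', List.prod_replicate, Finset.sum_const, Finset.card_univ,
    Fintype.card_bool, nsmul_eq_mul] at h1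
  rw [show ((2 : ℕ) : ℝ) * (r / 2) = r by push_cast; ring] at h1
  have h2 := (summable_geometric_of_lt_one hr0 hr1).sum_le_tsum (F.image List.length)
    fun n _ => pow_nonneg hr0 n
  rw [tsum_geometric_of_lt_one hr0 hr1] at h2
  have h3 : 0 < 1 - r := by linarith
  rw [← Finset.mul_sum]
  calc (1 - r) * ∑ w ∈ F, (r / 2) ^ w.length ≤ (1 - r) * (1 - r)⁻¹ := by
        gcongr; exact h1.trans h2
    _ = 1 := mul_inv_cancel₀ h3.ne'

end Words

/-! ### Phrase counts and entropy -/

section PhraseCount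

variable {B : Type*} (rule : UseRule) (D : ℕ) (z : ℕ → B)

lemma prod_map_word (P : B → ℝ) (p l : ℕ) :
    ((word z p l).map P).prod = ∏ i ∈ Finset.range l, P (z (p + i)) := by
  induction l with
  | zero => simp [word]
  | succ l ih => rw [word_succ, List.map_append, List.prod_append, ih, Finset.prod_range_succ]; simp

lemma prod_map_lzPhrase (P : B → ℝ) (j : ℕ) : ((lzPhrase rule D z j).map P).prod =
    ∏ i ∈ Finset.Ico (lzRun rule D z j).pos (lzRun rule D z (j + 1)).pos, P (z i) := by
  rw [lzPhrase, prod_map_word, Finset.prod_Ico_eq_prod_range, lzRun_succ_pos, Nat.add_sub_cancel_left]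

lemma sum_Ico_lzRun_pos (g : ℕ → ℝ) {a b : ℕ} (hab : a ≤ b) :
    ∑ j ∈ Finset.Ico a b,
      ∑ i ∈ Finset.Ico (lzRun rule D z j).pos (lzRun rule D z (j + 1)).pos, g i =
    ∑ i ∈ Finset.Ico (lzRun rule D z a).pos (lzRun rule D z b).pos, g i := by
  have hm := (lzRun_pos_strictMono rule D z).monotone
  induction b, hab using Nat.le_induction with
  | base => simp
  | succ b hab ih =>
    rw [Finset.sum_Ico_succ_top hab, ih]
    exact Finset.sum_Ico_consecutive g (hm hab) (hm (Nat.le_succ b))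

open Classical in
/-- Among `n` consecutive phrases, a word that is short enough to enter the dictionary occurs at most
`n / (D / 2) + 1` times. -/
lemma card_filter_lzPhrase_eq_le {a b : ℕ} (hD : 2 ≤ D) (w : List B) :
    ((Finset.Ico a b).filter fun j => lzMatch rule D z j + 1 ≤ Nat.log 2 D ^ 2 ∧
      lzPhrase rule D z j = w).card ≤ (b - a) / (D / 2) + 1 := by
  have hW : 0 < D / 2 := by omega
  rw [← Finset.card_range ((b - a) / (D / 2) + 1)]
  refine Finset.card_le_card_of_injOn (fun j => (j - a) / (D / 2)) (fun j hj => ?_) ?_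
  · simp only [Finset.coe_filter, Finset.mem_Ico, Set.mem_ofPred_eq] at hj
    simp only [Finset.coe_range, Set.mem_Iio]
    exact Nat.lt_succ_of_le (Nat.div_le_div_right (by omega))
  · have key : ∀ j j' : ℕ, a ≤ j → j < j' → lzMatch rule D z j + 1 ≤ Nat.log 2 D ^ 2 →
        lzPhrase rule D z j = lzPhrase rule D z j' → (j - a) / (D / 2) ≠ (j' - a) / (D / 2) := by
      intro j j' ha hj hs he heq
      have h1 := half_le_of_lzPhrase_eq rule D z hj hs he
      have h2 : (j - a) / (D / 2) + 1 ≤ (j' - a) / (D / 2) := by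
        rw [← Nat.add_div_right _ hW]
        exact Nat.div_le_div_right (by omega)
      omega
    intro j hj j' hj' heq
    simp only [Finset.coe_filter, Finset.mem_Ico, Set.mem_ofPred_eq] at hj hj'
    rcases lt_trichotomy j j' with h | h | h
    · exact absurd heq (key j j' hj.1.1 h hj.2.1 (hj.2.2.trans hj'.2.2.symm))
    · exact h
    · exact absurd heq.symm (key j' j hj'.1.1 h hj'.2.1 (hj'.2.2.trans hj.2.2.symm))

/-- The phrases that start in the stretch `[u, v)` of the input, in terms of the ideal code length of
the stretch for memoryless letter weights `P`. The weights of the distinct words of one length sum to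
at most `1`, so few phrases can have a weight above `1 / D`. -/
lemma lzPhrases_sub_mul_le [Fintype B] (P : B → ℝ) (hP : ∀ b, 0 ≤ P b) (hP1 : ∑ b, P b ≤ 1)
    (hD : 2 ≤ D) {u v : ℕ} (huv : u ≤ v) (hpos : ∀ i ∈ Finset.Ico u v, 0 < P (z i)) {Λ : ℝ}
    (hΛ : Λ = Real.log ((D / 2 : ℕ) : ℝ) - Real.log ((Nat.log 2 D ^ 2 : ℕ) : ℝ)) (hΛ0 : 0 ≤ Λ) :
    ((lzPhrases rule D z v : ℝ) - lzPhrases rule D z u) * Λ ≤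
      ∑ i ∈ Finset.Ico u v, -Real.log (P (z i)) + (Λ + (D / 2 : ℕ)) +
        ((v - u : ℕ) : ℝ) / ((Nat.log 2 D ^ 2 : ℕ) : ℝ) * (1 + Λ) := by
  classical
  set W := D / 2 with hW
  set l := Nat.log 2 D ^ 2 with hl
  have hW1 : 1 ≤ W := by omega
  have hl1 : 1 ≤ l := Nat.one_le_pow _ _ (Nat.log_pos (by norm_num) hD)
  have hWR : (0 : ℝ) < W := by exact_mod_cast hW1
  have hlR : (0 : ℝ) < l := by exact_mod_cast hl1
  set a := lzPhrases rule D z u with ha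
  have hnonneg : ∀ i ∈ Finset.Ico u v, 0 ≤ -Real.log (P (z i)) := fun i _ => by
    have : P (z i) ≤ 1 := (Finset.single_le_sum (fun b _ => hP b) (Finset.mem_univ (z i))).trans hP1
    linarith [Real.log_nonpos (hP (z i)) this]
  have hH0 : 0 ≤ ∑ i ∈ Finset.Ico u v, -Real.log (P (z i)) := Finset.sum_nonneg hnonneg
  have hX0 : 0 ≤ ((v - u : ℕ) : ℝ) / (l : ℝ) * (1 + Λ) := by positivity
  rcases Nat.lt_or_ge a (lzPhrases rule D z v) with hab | hab
  swap
  · have h1 : ((lzPhrases rule D z v : ℝ) - a) * Λ ≤ 0 :=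
      mul_nonpos_of_nonpos_of_nonneg (sub_nonpos.2 (by exact_mod_cast hab)) hΛ0
    linarith
  -- The last phrase that starts before `v` may end beyond `v` and is left out.
  obtain ⟨b, hb⟩ : ∃ b, lzPhrases rule D z v = b + 1 := ⟨lzPhrases rule D z v - 1, by omega⟩
  have hab' : a ≤ b := by omega
  have hm := (lzRun_pos_strictMono rule D z).monotone
  have hposa : u ≤ (lzRun rule D z a).pos := le_lzRun_pos_lzPhrases rule D z u
  have hposb : (lzRun rule D z b).pos < v := (lt_lzPhrases_iff rule D z).1 (by omega)
  have hIco : ∀ j ∈ Finset.Ico a b, Finset.Ico (lzRun rule D z j).pos (lzRun rule D z (j + 1)).pos ⊆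
      Finset.Ico u v := fun j hj => by
    rw [Finset.mem_Ico] at hj
    exact Finset.Ico_subset_Ico (hposa.trans (hm hj.1)) ((hm (show j + 1 ≤ b from hj.2)).trans hposb.le)
  set Q : ℕ → ℝ := fun j => ((lzPhrase rule D z j).map P).prod with hQ
  have hQpos : ∀ j ∈ Finset.Ico a b, 0 < Q j := fun j hj => by
    simp only [hQ, prod_map_lzPhrase]
    exact Finset.prod_pos fun i hi => hpos i (hIco j hj hi)
  have hQlog : ∀ j ∈ Finset.Ico a b, -Real.log (Q j) =
      ∑ i ∈ Finset.Ico (lzRun rule D z j).pos (lzRun rule D z (j + 1)).pos, -Real.log (P (z i)) :=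
    fun j hj => by
      simp only [hQ, prod_map_lzPhrase]
      rw [Real.log_prod fun i hi => (hpos i (hIco j hj hi)).ne', Finset.sum_neg_distrib]
  have hQnn : ∀ j ∈ Finset.Ico a b, 0 ≤ -Real.log (Q j) := fun j hj => by
    rw [hQlog j hj]
    exact Finset.sum_nonneg fun i hi => hnonneg i (hIco j hj hi)
  set Sh := (Finset.Ico a b).filter fun j => lzMatch rule D z j + 1 ≤ l with hSh
  set Lo := (Finset.Ico a b).filter fun j => ¬ lzMatch rule D z j + 1 ≤ l with hLo
  have hcard : (Sh.card : ℝ) + Lo.card = b - a := by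
    have := Finset.card_filter_add_card_filter_not (s := Finset.Ico a b)
      (fun j => lzMatch rule D z j + 1 ≤ l)
    rw [Nat.card_Ico] at this
    rw [← Nat.cast_sub hab']
    exact_mod_cast this
  have hIcosub : Finset.Ico (lzRun rule D z a).pos (lzRun rule D z b).pos ⊆ Finset.Ico u v :=
    Finset.Ico_subset_Ico hposa hposb.le
  have hShlog : ∑ j ∈ Sh, -Real.log (Q j) ≤ ∑ i ∈ Finset.Ico u v, -Real.log (P (z i)) :=
    calc ∑ j ∈ Sh, -Real.log (Q j) ≤ ∑ j ∈ Finset.Ico a b, -Real.log (Q j) :=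
          Finset.sum_le_sum_of_subset_of_nonneg (Finset.filter_subset _ _) fun j hj _ => hQnn j hj
      _ = ∑ i ∈ Finset.Ico (lzRun rule D z a).pos (lzRun rule D z b).pos, -Real.log (P (z i)) := by
          rw [← sum_Ico_lzRun_pos rule D z _ hab']
          exact Finset.sum_congr rfl hQlog
      _ ≤ _ := Finset.sum_le_sum_of_subset_of_nonneg hIcosub fun i hi _ => hnonneg i hi
  have hLocard : (Lo.card : ℝ) ≤ ((v - u : ℕ) : ℝ) / l := by
    rw [le_div_iff₀ hlR]
    have h1 : (Lo.card : ℝ) * l ≤ ∑ j ∈ Lo,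
        ∑ i ∈ Finset.Ico (lzRun rule D z j).pos (lzRun rule D z (j + 1)).pos, (1 : ℝ) := by
      rw [← nsmul_eq_mul]
      refine Finset.card_nsmul_le_sum _ _ _ fun j hj => ?_
      have h2 := (Finset.mem_filter.1 hj).2
      rw [Finset.sum_const, Nat.card_Ico, nsmul_eq_mul, mul_one, lzRun_succ_pos]
      exact_mod_cast (by omega)
    refine h1.trans ((Finset.sum_le_sum_of_subset_of_nonneg (Finset.filter_subset _ _)
      fun j _ _ => Finset.sum_nonneg fun _ _ => zero_le_one).trans ?_)
    rw [sum_Ico_lzRun_pos rule D z _ hab', Finset.sum_const, Nat.card_Ico, nsmul_eq_mul, mul_one]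
    exact_mod_cast (by omega)
  have hShQ : ∑ j ∈ Sh, Q j ≤ ((b - a) / W + 1) * l := by
    have hmult : ∀ w : List B, ((Sh.filter fun j => lzPhrase rule D z j = w).card : ℝ) ≤
        ((b : ℝ) - a) / W + 1 := fun w => by
      rw [hSh, Finset.filter_filter]
      have h1 := card_filter_lzPhrase_eq_le rule D z hD w (a := a) (b := b)
      rw [← hW, ← hl] at h1
      refine (Nat.cast_le.2 h1).trans ?_
      push_cast
      rw [← Nat.cast_sub hab']
      gcongr
      exact Nat.cast_div_le
    have hnn : ∀ w : List B, 0 ≤ (w.map P).prod := fun w => List.prod_nonneg fun x hx => by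
      obtain ⟨b, -, rfl⟩ := List.mem_map.1 hx
      exact hP b
    have hba : 0 ≤ ((b : ℝ) - a) / W + 1 := by
      rw [← Nat.cast_sub hab']; positivity
    calc ∑ j ∈ Sh, Q j
        = ∑ w ∈ Sh.image (lzPhrase rule D z),
            (Sh.filter fun j => lzPhrase rule D z j = w).card • (w.map P).prod :=
          Finset.sum_comp (fun w : List B => (w.map P).prod) (lzPhrase rule D z)
      _ ≤ ∑ w ∈ Sh.image (lzPhrase rule D z), (((b : ℝ) - a) / W + 1) * (w.map P).prod :=
          Finset.sum_le_sum fun w _ => by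
            rw [nsmul_eq_mul]; exact mul_le_mul_of_nonneg_right (hmult w) (hnn w)
      _ = (((b : ℝ) - a) / W + 1) * ∑ w ∈ Sh.image (lzPhrase rule D z), (w.map P).prod := by
          rw [Finset.mul_sum]
      _ ≤ (((b : ℝ) - a) / W + 1) * l := by
          refine mul_le_mul_of_nonneg_left ?_ hba
          refine (sum_prod_map_le_sum_pow P hP _).trans ?_
          have h0 : 0 ≤ ∑ b, P b := Finset.sum_nonneg fun b _ => hP b
          refine (Finset.sum_le_card_nsmul _ _ 1 fun n _ => pow_le_one₀ h0 hP1).trans ?_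
          rw [nsmul_eq_mul, mul_one]
          have h3 : ((Sh.image (lzPhrase rule D z)).image List.length) ⊆ Finset.Icc 1 l := by
            intro n hn
            obtain ⟨w, hw, rfl⟩ := Finset.mem_image.1 hn
            obtain ⟨j, hj, rfl⟩ := Finset.mem_image.1 hw
            have h4 := (Finset.mem_filter.1 hj).2
            rw [length_lzPhrase, Finset.mem_Icc]
            omega
          have h5 := Finset.card_le_card h3
          rw [Nat.card_Icc, Nat.add_sub_cancel] at h5
          exact_mod_cast h5
  have hlog : ∑ j ∈ Sh, (Λ + Real.log (Q j)) ≤ ∑ j ∈ Sh, ((W : ℝ) / l * Q j - 1) := by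
    refine Finset.sum_le_sum fun j hj => ?_
    have hq := hQpos j (Finset.mem_filter.1 hj).1
    have h1 : Λ + Real.log (Q j) = Real.log ((W : ℝ) / l * Q j) := by
      rw [Real.log_mul (by positivity) hq.ne', Real.log_div hWR.ne' hlR.ne', hΛ]
    rw [h1]
    exact Real.log_le_sub_one_of_pos (by positivity)
  rw [Finset.sum_add_distrib, Finset.sum_sub_distrib, ← Finset.mul_sum, Finset.sum_const,
    Finset.sum_const, nsmul_eq_mul, nsmul_eq_mul, mul_one] at hlog
  rw [Finset.sum_neg_distrib] at hShlog
  have h6 : (W : ℝ) / l * ∑ j ∈ Sh, Q j ≤ (b - a) + W := by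
    calc (W : ℝ) / l * ∑ j ∈ Sh, Q j ≤ (W : ℝ) / l * (((b - a) / W + 1) * l) := by gcongr
      _ = (b - a) + W := by field_simp
  have h7 : (Lo.card : ℝ) * (1 + Λ) ≤ ((v - u : ℕ) : ℝ) / l * (1 + Λ) := by gcongr
  rw [hb]
  push_cast
  have h8 : ((b : ℝ) + 1 - a) * Λ = Λ + Sh.card * Λ + Lo.card * Λ := by
    rw [← eq_sub_iff_add_eq'] at hcard
    rw [hcard]
    ring
  rw [h8]
  linarith

end PhraseCount

/-! ### The scheme does as well as finite-state encoders for vectors of the same length -/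

section UpperBound

variable {A : Type*} {d : (n : ℕ) → (Fin n → A) → (Fin n → A) → ℝ} {dmax : ℝ}

open Classical in
/-- The empirical entropy of a greedily quantized string, in nats, in terms of the bits that a
finite-state encoder spends on the string. The encoder groups the vectors by start state, end state
and output word. -/
lemma IsGreedyQuantization.entropy_le {L M s : ℕ} (hL : 1 ≤ L) (hs : 1 ≤ s)
    {B Q : Fin M → Fin L → A} (h : IsGreedyQuantization d dmax B Q) (E : FSDLEncoder d dmax L s)
    (σ : Fin M → Fin s) :
    ∑ m, -Real.log ((Finset.univ.filter fun m' => Q m' = Q m).card / M) ≤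
      M * (1 + 2 * Real.log s + Real.log (2 * L)) +
        (Real.log 2 + 1 / L) * ∑ m, ((E.out (σ m) (B m)).length : ℝ) := by
  have hLR : (1 : ℝ) ≤ L := by exact_mod_cast hL
  have hsR : (0 : ℝ) < s := by exact_mod_cast hs
  let κ : Fin M → (Fin s × Fin s) × List Bool :=
    fun m => ((σ m, E.next (σ m) (B m)), E.out (σ m) (B m))
  -- With this damping factor the overhead per vector is `log (2 * L)`, and each bit of the encoder
  -- is charged at most `log 2 + 1 / L`.
  obtain ⟨r, hr⟩ : ∃ r : ℝ, r = 1 - 1 / (2 * L) := ⟨_, rfl⟩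
  have h2L : 1 / (2 * (L : ℝ)) ≤ 1 / 2 := by
    apply one_div_le_one_div_of_le <;> linarith
  have h2L0 : 0 < 1 / (2 * (L : ℝ)) := by positivity
  have hr0 : 0 < r := by linarith
  have hr1 : r < 1 := by linarith
  let W : (Fin s × Fin s) × List Bool → ℝ :=
    fun t => ((s : ℝ) ^ 2)⁻¹ * ((1 - r) * (r / 2) ^ t.2.length)
  have hW : ∀ t, 0 < W t := fun t => by
    have : 0 < 1 - r := by linarith
    positivity
  have hWsum : ∀ F : Finset ((Fin s × Fin s) × List Bool), ∑ t ∈ F, W t ≤ 1 := fun F => by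
    calc ∑ t ∈ F, W t
        ≤ ∑ t ∈ Finset.univ ×ˢ (F.image Prod.snd), W t := by
          refine Finset.sum_le_sum_of_subset_of_nonneg (fun t ht => ?_) fun t _ _ => (hW t).le
          exact Finset.mem_product.2 ⟨Finset.mem_univ _, Finset.mem_image_of_mem _ ht⟩
      _ = ∑ w ∈ F.image Prod.snd, (1 - r) * (r / 2) ^ w.length := by
          rw [Finset.sum_product]
          simp only [W]
          rw [Finset.sum_const, ← Finset.mul_sum, Finset.card_univ, Fintype.card_prod,
            Fintype.card_fin, nsmul_eq_mul, ← mul_assoc]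
          push_cast
          rw [← sq, mul_inv_cancel₀ (by positivity), one_mul]
      _ ≤ 1 := sum_damped_kraft_le hr0.le hr1 _
  have hκ : ∀ m, ∃ w, ∀ m', κ m' = κ m → d L (B m') w ≤ L * dmax := fun m => by
    refine ⟨E.decode (σ m) (E.next (σ m) (B m)) (E.out (σ m) (B m)), fun m' hm' => ?_⟩
    have h1 := E.distortion_le (σ m') (B m')
    simp only [κ, Prod.mk.injEq] at hm'
    rw [hm'.2, hm'.1.2, hm'.1.1] at h1
    exact h1
  have h1 := h.sum_log_card_ge κ hκ
  have h2 := sum_log_card_div_le κ W hW hWsum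
  rw [Fintype.card_fin, Finset.sum_sub_distrib] at h2
  have h3 : ∀ m, -Real.log (W (κ m)) ≤ 2 * Real.log s + Real.log (2 * L) +
      (Real.log 2 + 1 / L) * ((E.out (σ m) (B m)).length : ℝ) := fun m => by
    have hr' : -Real.log r ≤ 1 / L := by
      rw [← Real.log_inv]
      refine (Real.log_le_sub_one_of_pos (inv_pos.2 hr0)).trans ?_
      have h4 : (1 / 2 : ℝ) ≤ r := by linarith
      have h5 : r⁻¹ ≤ 2 := by
        rw [inv_le_comm₀ hr0 (by norm_num)]; linarith
      have h6 : r⁻¹ - 1 = r⁻¹ * (1 / (2 * L)) := by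
        rw [show 1 / (2 * (L : ℝ)) = 1 - r by linarith, mul_sub, inv_mul_cancel₀ hr0.ne', mul_one]
      rw [h6]
      calc r⁻¹ * (1 / (2 * L)) ≤ 2 * (1 / (2 * L)) := by gcongr
        _ = 1 / L := by field_simp
    have h1r : 1 - r = (2 * (L : ℝ))⁻¹ := by rw [hr]; simp
    have hne : (1 - r) ≠ 0 := by linarith
    simp only [W, κ]
    rw [Real.log_mul (by positivity) (mul_ne_zero hne (by positivity)), Real.log_inv, Real.log_pow,
      Real.log_mul hne (by positivity), h1r, Real.log_inv, Real.log_pow,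
      Real.log_div hr0.ne' (by norm_num)]
    have h7 : (0 : ℝ) ≤ ((E.out (σ m) (B m)).length : ℝ) := Nat.cast_nonneg _
    have h8 := mul_le_mul_of_nonneg_left hr' h7
    push_cast
    linarith
  have h4 := Finset.sum_le_sum fun m (_ : m ∈ (Finset.univ : Finset (Fin M))) => h3 m
  rw [Finset.sum_add_distrib, ← Finset.mul_sum, Finset.sum_const, Finset.card_univ,
    Fintype.card_fin, nsmul_eq_mul] at h4
  have h5 : ∀ m, -Real.log ((Finset.univ.filter fun m' => Q m' = Q m).card / M) =
      Real.log M - Real.log (Finset.univ.filter fun m' => Q m' = Q m).card := fun m => by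
    have hM : (M : ℝ) ≠ 0 := by
      have := m.pos
      exact_mod_cast this.ne'
    have hc : ((Finset.univ.filter fun m' => Q m' = Q m).card : ℝ) ≠ 0 := by
      exact_mod_cast (Finset.card_pos.2 ⟨m, by simp⟩).ne'
    rw [Real.log_div hc hM, neg_sub]
  rw [Finset.sum_congr rfl fun m _ => h5 m, Finset.sum_sub_distrib]
  linarith

/-- The number of phrases of the first `K` quantized strings in terms of the number of bits that a
finite-state encoder spends on the same strings. -/
lemma lzPhrases_mul_le_bits [Fintype A] (rule : UseRule) {D L M s : ℕ} (hD : 2 ≤ D) (hL : 1 ≤ L)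
    (hM : 1 ≤ M) (hs : 1 ≤ s) {x : ℕ → A} {z : ℕ → Fin L → A}
    (hz : ∀ k, IsGreedyQuantization d dmax (fun m : Fin M => block x L (k * M + m))
      (fun m : Fin M => z (k * M + m)))
    (E : FSDLEncoder d dmax L s) (q : Fin s) {Λ : ℝ}
    (hΛ : Λ = Real.log ((D / 2 : ℕ) : ℝ) - Real.log ((Nat.log 2 D ^ 2 : ℕ) : ℝ)) (hΛ0 : 0 ≤ Λ)
    (K : ℕ) :
    lzPhrases rule D z (K * M) * Λ ≤ K * (Λ + (D / 2 : ℕ) +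
      M / ((Nat.log 2 D ^ 2 : ℕ) : ℝ) * (1 + Λ) + M * (1 + 2 * Real.log s + Real.log (2 * L))) +
      (Real.log 2 + 1 / L) * E.bits q x (K * M) := by
  classical
  induction K with
  | zero =>
    have : lzPhrases rule D z 0 = 0 := by simp [lzPhrases]
    simp [this, FSDLEncoder.bits]
  | succ K ih =>
    let P : (Fin L → A) → ℝ := fun b =>
      (Finset.univ.filter fun m : Fin M => z (K * M + m) = b).card / M
    have hMR : (0 : ℝ) < M := by exact_mod_cast hM
    have hP1 : ∑ b, P b ≤ 1 := by
      simp only [P]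
      have := Finset.card_eq_sum_card_fiberwise (s := (Finset.univ : Finset (Fin M)))
        (t := (Finset.univ : Finset (Fin L → A))) (f := fun m : Fin M => z (K * M + m))
        fun m _ => Finset.mem_coe.2 (Finset.mem_univ _)
      rw [← Finset.sum_div, ← Nat.cast_sum, ← this, Finset.card_univ, Fintype.card_fin,
        div_self hMR.ne']
    have hpos : ∀ i ∈ Finset.Ico (K * M) (K * M + M), 0 < P (z i) := fun i hi => by
      rw [Finset.mem_Ico] at hi
      have : 0 < (Finset.univ.filter fun m : Fin M => z (K * M + m) = z i).card :=
        Finset.card_pos.2 ⟨⟨i - K * M, by omega⟩, by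
          rw [Finset.mem_filter]
          exact ⟨Finset.mem_univ _, by rw [Nat.add_sub_cancel' hi.1]⟩⟩
      have h2 : (0 : ℝ) < ((Finset.univ.filter fun m : Fin M => z (K * M + m) = z i).card : ℝ) := by
        exact_mod_cast this
      exact div_pos h2 hMR
    have h1 := lzPhrases_sub_mul_le rule D z P (fun b => by positivity) hP1 hD
      (Nat.le_add_right (K * M) M) hpos hΛ hΛ0
    have h2 := (hz K).entropy_le hL hs E fun m => E.stateAt q x (K * M + m)
    have h3 : ∑ i ∈ Finset.Ico (K * M) (K * M + M), -Real.log (P (z i)) =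
        ∑ m : Fin M, -Real.log (P (z (K * M + m))) := by
      rw [Finset.sum_Ico_eq_sum_range, Nat.add_sub_cancel_left,
        Finset.sum_range fun m => -Real.log (P (z (K * M + m)))]
    have h4 : (E.bits q x ((K + 1) * M) : ℝ) = E.bits q x (K * M) + ∑ m : Fin M,
        ((E.out (E.stateAt q x (K * M + m)) (block x L (K * M + m))).length : ℝ) := by
      rw [FSDLEncoder.bits, FSDLEncoder.bits, Nat.succ_mul, Finset.sum_range_add, Nat.cast_add,
        Finset.sum_range fun m => (E.out (E.stateAt q x (K * M + m))
          (block x L (K * M + m))).length]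
      simp only [Nat.cast_sum]
    rw [h3, Nat.add_sub_cancel_left] at h1
    rw [h4, Nat.succ_mul]
    simp only [P] at h1
    push_cast at h1 h2 ih ⊢
    rw [sub_mul] at h1
    linarith

end UpperBound

/-! ### Convergence of the compression ratios -/

section Convergence

variable {A : Type*} {d : (n : ℕ) → (Fin n → A) → (Fin n → A) → ℝ} {dmax : ℝ}

lemma one_le_logb_two_natCast {q : ℕ} (hq : 2 ≤ q) : 1 ≤ Real.logb 2 q := by
  rw [Real.le_logb_iff_rpow_le (by norm_num) (by exact_mod_cast (by omega : 0 < q)), Real.rpow_one]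
  exact_mod_cast hq

lemma log_half_dictSize_sub {L : ℕ} (hL : 1 ≤ L) :
    Real.log ((dictSize L / 2 : ℕ) : ℝ) - Real.log ((Nat.log 2 (dictSize L) ^ 2 : ℕ) : ℝ) =
      ((L : ℝ) ^ 3 - 1) * Real.log 2 - 6 * Real.log L := by
  have h3 : 1 ≤ L ^ 3 := Nat.one_le_pow _ _ hL
  have h1 : dictSize L / 2 = 2 ^ (L ^ 3 - 1) := by
    obtain ⟨k, hk⟩ : ∃ k, L ^ 3 = k + 1 := ⟨L ^ 3 - 1, by omega⟩
    rw [dictSize, hk, pow_succ, Nat.mul_div_cancel _ (by norm_num), Nat.add_sub_cancel]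
  have h2 : Nat.log 2 (dictSize L) = L ^ 3 := by
    rw [dictSize, Nat.log_pow (by norm_num)]
  rw [h1, h2]
  push_cast
  rw [Real.log_pow, ← pow_mul, Real.log_pow, Nat.cast_sub h3]
  push_cast
  ring

lemma logb_dictSize (L : ℕ) : Real.logb 2 (dictSize L) = (L : ℝ) ^ 3 := by
  rw [dictSize]
  push_cast
  rw [Real.logb_pow, Real.logb_self_eq_one (by norm_num), mul_one]
  push_cast
  rfl

/-- The ratio between the code length of a phrase and the ideal code length, in nats, that each phrase
is guaranteed to cover. -/
lemma tendsto_phraseCost (b : ℝ) :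
    Tendsto (fun L : ℕ => ((L : ℝ) ^ 3 + 1 + L * b) /
      (((L : ℝ) ^ 3 - 1) * Real.log 2 - 6 * Real.log L)) atTop (𝓝 (1 / Real.log 2)) := by
  have hc := tendsto_natCast_atTop_atTop (R := ℝ)
  have hlog2 : Real.log 2 ≠ 0 := (Real.log_pos (by norm_num)).ne'
  have h3 : Tendsto (fun L : ℕ => ((L : ℝ) ^ 3)⁻¹) atTop (𝓝 0) :=
    ((tendsto_pow_atTop (by norm_num)).comp hc).inv_tendsto_atTop
  have h2 : Tendsto (fun L : ℕ => ((L : ℝ) ^ 2)⁻¹) atTop (𝓝 0) :=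
    ((tendsto_pow_atTop (by norm_num)).comp hc).inv_tendsto_atTop
  have hl : Tendsto (fun L : ℕ => Real.log L / (L : ℝ) ^ 3) atTop (𝓝 0) := by
    have := (Real.isLittleO_pow_log_id_atTop (n := 1)).tendsto_div_nhds_zero.comp hc
    have h := this.mul h2
    rw [mul_zero] at h
    refine h.congr fun L => ?_
    simp only [Function.comp, id, pow_one]
    rw [div_mul_eq_mul_div, ← div_eq_mul_inv, div_div]
    congr 1
  have hnum := ((tendsto_const_nhds (x := (1 : ℝ))).add h3).add (h2.mul_const b)
  have hden := (((tendsto_const_nhds (x := (1 : ℝ))).sub h3).mul_const (Real.log 2)).sub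
    (hl.const_mul 6)
  have h := hnum.div hden (by simpa using hlog2)
  simp only [add_zero, zero_mul, sub_zero, one_mul, mul_zero] at h
  refine h.congr' ?_
  filter_upwards [eventually_ge_atTop 1] with L hL
  have hLR : (0 : ℝ) < L := by exact_mod_cast hL
  have e1 : (1 : ℝ) + ((L : ℝ) ^ 3)⁻¹ + ((L : ℝ) ^ 2)⁻¹ * b = ((L : ℝ) ^ 3 + 1 + L * b) / L ^ 3 := by
    field_simp
  have e2 : (1 - ((L : ℝ) ^ 3)⁻¹) * Real.log 2 - 6 * (Real.log L / (L : ℝ) ^ 3) =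
      (((L : ℝ) ^ 3 - 1) * Real.log 2 - 6 * Real.log L) / L ^ 3 := by
    field_simp
  show (1 + ((L : ℝ) ^ 3)⁻¹ + ((L : ℝ) ^ 2)⁻¹ * b) /
    ((1 - ((L : ℝ) ^ 3)⁻¹) * Real.log 2 - 6 * (Real.log L / (L : ℝ) ^ 3)) = _
  rw [e1, e2, div_div_div_cancel_right₀ (by positivity)]

lemma tendsto_overhead (a r : ℝ) :
    Tendsto (fun L : ℕ => (a + Real.log (2 * L)) / L + (Real.log 2 + 1 / L) * r) atTop
      (𝓝 (Real.log 2 * r)) := by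
  have hc := tendsto_natCast_atTop_atTop (R := ℝ)
  have h1 : Tendsto (fun L : ℕ => Real.log L / L) atTop (𝓝 0) := by
    have := (Real.isLittleO_pow_log_id_atTop (n := 1)).tendsto_div_nhds_zero.comp hc
    simpa [Function.comp_def] using this
  have h2 := tendsto_const_div_atTop_nhds_zero_nat (a + Real.log 2)
  have h3 := ((tendsto_const_div_atTop_nhds_zero_nat (1 : ℝ)).const_add (Real.log 2)).mul_const r
  have h := (h2.add h1).add h3
  simp only [add_zero, zero_add] at h
  refine h.congr' ?_
  filter_upwards [eventually_ge_atTop 1] with L hL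
  have hLR : (L : ℝ) ≠ 0 := by exact_mod_cast (by omega : L ≠ 0)
  rw [Real.log_mul (by norm_num) hLR]
  ring

/-- If some finite-state encoder stays below the ratio `r` on the first `K` strings, then the scheme
stays below a bound that tends to `r` as `L` grows. -/
lemma lzBits_div_le [Fintype A] (hA : 2 ≤ Fintype.card A) (rule : UseRule) {L M s : ℕ} (hL : 1 ≤ L)
    (hM : dictSize L ≤ M) (hs : 1 ≤ s) {x : ℕ → A} {z : ℕ → Fin L → A}
    (hz : ∀ k, IsGreedyQuantization d dmax (fun m : Fin M => block x L (k * M + m))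
      (fun m : Fin M => z (k * M + m)))
    (hΛ0 : 0 < ((L : ℝ) ^ 3 - 1) * Real.log 2 - 6 * Real.log L) {K : ℕ} (hK : 1 ≤ K) {r : ℝ}
    (hr : FSLDFinite d dmax s L (K * M) x < r) :
    lzBits rule (dictSize L) z (K * M) / (((K * (L * M) : ℕ) : ℝ) * Real.logb 2 (Fintype.card A)) ≤
      ((L : ℝ) ^ 3 + 1 + L * Real.logb 2 (Fintype.card A)) /
        (((L : ℝ) ^ 3 - 1) * Real.log 2 - 6 * Real.log L) *
      ((5 + 2 * Real.log s + Real.log (2 * L)) / L + (Real.log 2 + 1 / L) * r) := by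
  obtain ⟨E, hE⟩ := iInf_lt_iff.1 hr
  obtain ⟨q, hq⟩ := iInf_lt_iff.1 hE
  rw [EReal.coe_lt_coe_iff] at hq
  have hD1 : 1 ≤ dictSize L := Nat.one_le_two_pow
  have hL3 : 1 ≤ L ^ 3 := Nat.one_le_pow _ _ hL
  have hD2 : 2 ≤ dictSize L := by
    calc 2 = 2 ^ 1 := rfl
      _ ≤ 2 ^ L ^ 3 := Nat.pow_le_pow_right (by norm_num) hL3
  have hM1 : 1 ≤ M := hD1.trans hM
  obtain ⟨Λ, hΛ⟩ : ∃ Λ, Λ = ((L : ℝ) ^ 3 - 1) * Real.log 2 - 6 * Real.log L := ⟨_, rfl⟩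
  rw [← hΛ] at hΛ0 ⊢
  have key := lzPhrases_mul_le_bits rule hD2 hL hM1 hs hz E q
    (hΛ.trans (log_half_dictSize_sub hL).symm) hΛ0.le K
  have hlq := one_le_logb_two_natCast hA
  set lq := Real.logb 2 (Fintype.card A) with hlq_def
  have hLR : (1 : ℝ) ≤ L := by exact_mod_cast hL
  have hMR : (1 : ℝ) ≤ M := by exact_mod_cast hM1
  have hKR : (1 : ℝ) ≤ K := by exact_mod_cast hK
  have hlogs : 0 ≤ Real.log s := Real.log_nonneg (by exact_mod_cast hs)
  have hlogL : 0 ≤ Real.log L := Real.log_nonneg hLR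
  have hlog2L : 0 ≤ Real.log (2 * L) := Real.log_nonneg (by linarith)
  have hl : ((Nat.log 2 (dictSize L) ^ 2 : ℕ) : ℝ) = (L : ℝ) ^ 6 := by
    rw [dictSize, Nat.log_pow (by norm_num)]
    push_cast
    ring
  have hΛL : Λ ≤ (L : ℝ) ^ 3 := by
    have h1 : Real.log 2 ≤ 1 := by linarith [Real.log_two_lt_d9]
    have h2 : (1 : ℝ) ≤ (L : ℝ) ^ 3 := one_le_pow₀ hLR
    have h3 : ((L : ℝ) ^ 3 - 1) * Real.log 2 ≤ ((L : ℝ) ^ 3 - 1) * 1 :=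
      mul_le_mul_of_nonneg_left h1 (by linarith)
    linarith
  have hfirst : Λ + (dictSize L / 2 : ℕ) ≤ 2 * M := by
    have h1 : (L : ℝ) ^ 3 ≤ M := by
      have : L ^ 3 ≤ M := Nat.lt_two_pow_self.le.trans hM
      exact_mod_cast this
    have h2 : ((dictSize L / 2 : ℕ) : ℝ) ≤ M := by
      exact_mod_cast (Nat.div_le_self _ _).trans hM
    linarith
  have hsecond : M / (L : ℝ) ^ 6 * (1 + Λ) ≤ 2 * M := by
    have h1 : (1 : ℝ) ≤ (L : ℝ) ^ 6 := one_le_pow₀ hLR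
    have h2 : (L : ℝ) ^ 3 ≤ (L : ℝ) ^ 6 := pow_le_pow_right₀ hLR (by norm_num)
    rw [div_mul_eq_mul_div, div_le_iff₀ (by positivity)]
    have h3 : (M : ℝ) * (1 + Λ) ≤ M * (2 * (L : ℝ) ^ 6) :=
      mul_le_mul_of_nonneg_left (by linarith) (by positivity)
    linarith
  rw [hl] at key
  have hden : 0 < ((K * M * L : ℕ) : ℝ) * lq := by
    have : 0 < K * M * L := Nat.mul_pos (Nat.mul_pos hK hM1) hL
    have h0 : (0 : ℝ) < ((K * M * L : ℕ) : ℝ) := by exact_mod_cast this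
    exact mul_pos h0 (by linarith)
  rw [div_lt_iff₀ hden] at hq
  rw [show K * (L * M) = K * M * L by ring]
  have hβ : Real.logb 2 (dictSize L) + 1 + Real.logb 2 (Fintype.card (Fin L → A)) =
      (L : ℝ) ^ 3 + 1 + L * lq := by
    rw [logb_dictSize, Fintype.card_fun, Fintype.card_fin]
    push_cast
    rw [Real.logb_pow]
  rw [lzBits, hβ]
  set β := (L : ℝ) ^ 3 + 1 + L * lq with hβ_def
  have hβ0 : 0 ≤ β := by positivity
  set X := (5 + 2 * Real.log s + Real.log (2 * L)) / L + (Real.log 2 + 1 / L) * r with hX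
  have hmain : (lzPhrases rule (dictSize L) z (K * M) : ℝ) * Λ ≤
      X * (((K * M * L : ℕ) : ℝ) * lq) := by
    refine key.trans ?_
    have hco : 0 ≤ Real.log 2 + 1 / L := by
      have : 0 ≤ Real.log 2 := Real.log_nonneg (by norm_num)
      positivity
    have h1 := mul_le_mul_of_nonneg_left hq.le hco
    have h2 : (5 + 2 * Real.log s + Real.log (2 * L)) / L * (((K * M * L : ℕ) : ℝ) * lq) =
        K * (M * (5 + 2 * Real.log s + Real.log (2 * L))) * lq := by
      push_cast
      field_simp
    have h3 : K * (Λ + (dictSize L / 2 : ℕ) + M / (L : ℝ) ^ 6 * (1 + Λ) +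
        M * (1 + 2 * Real.log s + Real.log (2 * L))) ≤
        K * (M * (5 + 2 * Real.log s + Real.log (2 * L))) :=
      mul_le_mul_of_nonneg_left (by linarith) (by linarith)
    have h4 : K * (M * (5 + 2 * Real.log s + Real.log (2 * L))) ≤
        K * (M * (5 + 2 * Real.log s + Real.log (2 * L))) * lq :=
      le_mul_of_one_le_right (by positivity) hlq
    have h5 : X * (((K * M * L : ℕ) : ℝ) * lq) =
        K * (M * (5 + 2 * Real.log s + Real.log (2 * L))) * lq +
          (Real.log 2 + 1 / L) * (r * (((K * M * L : ℕ) : ℝ) * lq)) := by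
      rw [hX, add_mul, h2, mul_assoc (Real.log 2 + 1 / (L : ℝ))]
    rw [h5]
    linarith only [h1, h3, h4]
  rw [div_le_iff₀ hden, div_mul_eq_mul_div, div_mul_eq_mul_div, le_div_iff₀ hΛ0]
  calc _ = (lzPhrases rule (dictSize L) z (K * M) : ℝ) * Λ * β := by ring
    _ ≤ X * (((K * M * L : ℕ) : ℝ) * lq) * β := mul_le_mul_of_nonneg_right hmain hβ0
    _ = _ := by ring

/-- With vectors of the same length, no number of states lets a finite-state encoder beat the scheme
in the limit. -/
lemma limsup_schemeRatio_le [Fintype A] (hA : 2 ≤ Fintype.card A) (x : ℕ → A) (rule : UseRule)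
    (N : ℕ → ℕ)
    (hN : ∀ L : ℕ, 1 ≤ L →
      L ∣ N L ∧ (dictSize L : ℝ) * Real.logb 2 (dictSize L) ≤ (N L : ℝ))
    (z : (L : ℕ) → ℕ → Fin L → A) (hz : ∀ L : ℕ, 1 ≤ L → IsGreedyOutput d dmax x L (N L) (z L))
    {s : ℕ} (hs : 1 ≤ s) :
    limsup (fun L : ℕ => schemeRatio rule L (N L) (z L)) atTop ≤
      limsup (fun L : ℕ => limsup (fun c : ℕ => FSLDFinite d dmax s L c x) atTop) atTop := by
  refine EReal.le_of_forall_lt_iff_le.1 fun r hr => ?_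
  have hlim := (tendsto_phraseCost (Real.logb 2 (Fintype.card A))).mul
    (tendsto_overhead (5 + 2 * Real.log s) r)
  rw [← mul_assoc, one_div, inv_mul_cancel₀ (Real.log_pos (by norm_num)).ne', one_mul] at hlim
  have hpos := (tendsto_phraseCost 0).eventually
    (lt_mem_nhds (show (0 : ℝ) < 1 / Real.log 2 from one_div_pos.2 (Real.log_pos (by norm_num))))
  rw [← ((continuous_coe_real_ereal.tendsto r).comp hlim).limsup_eq]
  refine limsup_le_limsup ?_
  filter_upwards [eventually_lt_of_limsup_lt hr, hpos, eventually_ge_atTop 1] with L hL hΛ hL1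
  obtain ⟨⟨M, hM⟩, hN2⟩ := hN L hL1
  have hLR : (1 : ℝ) ≤ L := by exact_mod_cast hL1
  have hΛ0 : 0 < ((L : ℝ) ^ 3 - 1) * Real.log 2 - 6 * Real.log L :=
    (div_pos_iff_of_pos_left (by positivity)).1 hΛ
  have hNM : N L / L = M := by rw [hM, Nat.mul_div_cancel_left M hL1]
  have hDM : dictSize L ≤ M := by
    rw [logb_dictSize, hM] at hN2
    have h1 : dictSize L * L ^ 3 ≤ L * M := by exact_mod_cast hN2
    have h2 : dictSize L * L * L ^ 2 ≤ M * L := by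
      calc _ = dictSize L * L ^ 3 := by ring
        _ ≤ _ := h1
        _ = _ := mul_comm _ _
    have h3 : dictSize L * L ≤ M * L :=
      (Nat.le_mul_of_pos_right _ (Nat.pow_pos hL1)).trans h2
    exact Nat.le_of_mul_le_mul_right h3 hL1
  have hM1 : 0 < M := lt_of_lt_of_le (Nat.pow_pos (by norm_num)) hDM
  have hzL := hz L hL1
  unfold IsGreedyOutput at hzL
  rw [hNM] at hzL
  have hKM : Tendsto (fun K : ℕ => K * M) atTop atTop := tendsto_id.atTop_mul_const' hM1
  unfold schemeRatio
  refine limsup_le_of_le (h := ?_)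
  filter_upwards [hKM.eventually (eventually_lt_of_limsup_lt hL), eventually_ge_atTop 1] with K hK hK1
  rw [hNM, hM]
  exact EReal.coe_le_coe_iff.2 (lzBits_div_le hA rule hL1 hDM hs hzL hΛ0 hK1 hK)

end Convergence

theorem theorem2 {A : Type*} [Fintype A] (hA : 2 ≤ Fintype.card A)
    (d : (n : ℕ) → (Fin n → A) → (Fin n → A) → ℝ) (dmax : ℝ)
    (hsub : SubadditiveDistortion d) (hrep : AdmitsReproduction d dmax)
    (x : ℕ → A) (rule : UseRule) (N : ℕ → ℕ)
    (hN : ∀ L : ℕ, 1 ≤ L →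
      L ∣ N L ∧ (dictSize L : ℝ) * Real.logb 2 (dictSize L) ≤ (N L : ℝ)) :
    (∀ L : ℕ, 1 ≤ L → ∃ z : ℕ → Fin L → A, IsGreedyOutput d dmax x L (N L) z) ∧
    ∀ z : (L : ℕ) → ℕ → Fin L → A,
      (∀ L : ℕ, 1 ≤ L → IsGreedyOutput d dmax x L (N L) (z L)) →
        (∀ L : ℕ, 1 ≤ L → ∀ m : ℕ, d L (block x L m) (z L m) ≤ L * dmax) ∧
        Tendsto (fun L : ℕ => schemeRatio rule L (N L) (z L)) atTop (𝓝 (FSLD d dmax x)) := by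
  have : Nonempty A := Fintype.card_pos_iff.1 (by omega)
  have hNpos : ∀ L, 1 ≤ L → 0 < N L := fun L hL => by
    have h1 := (hN L hL).2
    rw [logb_dictSize] at h1
    have h2 : (0 : ℝ) < dictSize L := by exact_mod_cast (Nat.pow_pos (by norm_num) : 0 < 2 ^ L ^ 3)
    have h3 : (0 : ℝ) < L := by exact_mod_cast hL
    have h4 : (0 : ℝ) < N L := lt_of_lt_of_le (by positivity) h1
    exact_mod_cast h4
  have hMpos : ∀ L, 1 ≤ L → 0 < N L / L := fun L hL =>
    Nat.div_pos (Nat.le_of_dvd (hNpos L hL) (hN L hL).1) hL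
  refine ⟨fun L hL => ?_, fun z hz => ?_⟩
  · choose Q hQ using fun k : ℕ => exists_isGreedyQuantization (hrep L hL)
      (fun m : Fin (N L / L) => block x L (k * (N L / L) + m))
    refine ⟨fun p => Q (p / (N L / L)) ⟨p % (N L / L), Nat.mod_lt _ (hMpos L hL)⟩, fun k => ?_⟩
    convert hQ k using 2 with m
    have h1 : (k * (N L / L) + (m : ℕ)) / (N L / L) = k := by
      rw [add_comm, Nat.add_mul_div_right _ _ (hMpos L hL), Nat.div_eq_of_lt m.2, zero_add]
    have h2 : (k * (N L / L) + (m : ℕ)) % (N L / L) = m := by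
      rw [add_comm, Nat.add_mul_mod_self_right, Nat.mod_eq_of_lt m.2]
    simp only [h1, h2]
  · have hdist : ∀ L : ℕ, 1 ≤ L → ∀ m : ℕ, d L (block x L m) (z L m) ≤ L * dmax := by
      intro L hL m
      have h := (hz L hL (m / (N L / L))).le ⟨m % (N L / L), Nat.mod_lt _ (hMpos L hL)⟩
      simpa only [Nat.div_add_mod'] using h
    refine ⟨hdist, tendsto_of_le_liminf_of_limsup_le ?_ ?_⟩
    · refine le_liminf_of_le (h := (eventually_ge_atTop 1).mono fun L hL => ?_)
      exact FSLD_le_schemeRatio hA hsub hrep x rule hL (hNpos L hL) (hN L hL).1 (z L) (hdist L hL)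
    · rw [← limsup_const (f := (atTop : Filter ℕ))
        (limsup (fun L : ℕ => schemeRatio rule L (N L) (z L)) atTop)]
      exact limsup_le_limsup ((eventually_ge_atTop 1).mono fun s hs =>
        limsup_schemeRatio_le hA x rule N hN z hz hs)
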